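/- Let $G$ be a compact Lie group, and let $\tau$ be a (continuous, finite-dimensional, complex) irreducible representation of $G$ whose character $\chi^\tau$ is not real valued. Let $\bar\tau$ be the complex conjugate representation and, for an irreducible representation $\phi$ of $G$, let $m_\phi[(\tau+\bar\tau)^2]$ denote the multiplicity of $\phi$ in $(\tau\oplus\bar\tau)\otimes(\tau\oplus\bar\tau)$. Let $\alpha\in G$, $\alpha\neq 1$, be such that $\alpha$ and $\alpha^{-1}$ are conjugate in $G$. Then $\chi^\tau(\alpha)$ and all $\chi^\phi(\alpha)$ are real and only finitely many of the multiplicities $m_\phi[(\tau+\bar\tau)^2]$ are non-zero. Put $a=1-\frac{\chi^\tau(\alpha)}{\dim(\tau)}$ and assume $a\neq 0$. Let $W=\frac{1}{\sqrt2}\left(\chi^\tau(g)+\overline{\chi^\tau(g)}\right)$, where $g$ is chosen from the normalized Haar measure of $G$. Then for all real $x_0$, \[ \left|\mathbb{P}(W\le x_0)-\frac{1}{\sqrt{2\pi}}\int_{-\infty}^{x_0}e^{-x^2/2}\,dx\right| \le \frac12\sqrt{\sum_{\phi}^{\ \ *} m_\phi[(\tau+\bar\tau)^2]^2\left[2-\frac1a\left(1-\frac{\chi^\phi(\alpha)}{\dim(\phi)}\right)\right]^2}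 +\left[\frac1\pi\sum_\phi m_\phi[(\tau+\bar\tau)^2]^2\left(2-\frac{3}{2a}\left(1-\frac{\chi^\phi(\alpha)}{\dim(\phi)}\right)\right)\right]^{1/4}. \] Here the second sum is over all irreducible representations $\phi$ of $G$ up to isomorphism, and the first (starred) sum is over the non-trivial ones. -/

import Mathlib

open scoped Manifold ContDiff TensorProduct ComplexConjugate

noncomputable section

/-- The action map `G × V → V` of the representation `ρ` is continuous. -/
def Representation.IsContinuousAction {G V : Type*} [Monoid G] [TopologicalSpace G]
    [AddCommGroup V] [Module ℂ V] [TopologicalSpace V] (ρ : Representation ℂ G V) : Prop :=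
  Continuous fun p : G × V => ρ p.1 p.2

/-- The complex conjugate of a complex vector space `V`: the same additive group, with the scalar
`c` acting as the conjugate of `c` acts on `V`. -/
def ConjSpace (V : Type*) : Type _ := V

instance ConjSpace.instAddCommGroup (V : Type*) [AddCommGroup V] : AddCommGroup (ConjSpace V) :=
  inferInstanceAs (AddCommGroup V)

instance ConjSpace.instModule (V : Type*) [AddCommGroup V] [Module ℂ V] :
    Module ℂ (ConjSpace V) :=
  Module.compHom V (starRingEnd ℂ)

/-- The complex conjugate of a representation: every group element acts by the same map, on the
conjugate vector space. -/
def Representation.conjRep {G V : Type*} [Monoid G] [AddCommGroup V] [Module ℂ V]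
    (ρ : Representation ℂ G V) : Representation ℂ G (ConjSpace V) where
  toFun g :=
    { toFun := fun v => ρ g (show V from v)
      map_add' := fun v w => (ρ g).map_add v w
      map_smul' := fun c v => (ρ g).map_smul (conj c) (show V from v) }
  map_one' := by
    apply LinearMap.ext
    intro v
    show ρ 1 (show V from v) = v
    rw [map_one]
    rfl
  map_mul' g h := by
    apply LinearMap.ext
    intro v
    show ρ (g * h) (show V from v) = ρ g (ρ h (show V from v))
    rw [map_mul]
    rfl

/-- The multiplicity of an irreducible complex representation `σ` in a finite-dimensional
completely reducible representation `ρ`: the dimension of `Hom_G(σ, ρ)`. -/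
def Representation.multiplicity {G V W : Type*} [Monoid G] [AddCommGroup V] [Module ℂ V]
    [AddCommGroup W] [Module ℂ W] (σ : Representation ℂ G V) (ρ : Representation ℂ G W) : ℕ :=
  Module.finrank ℂ (Representation.IntertwiningMap σ ρ)

/-- A continuous irreducible finite-dimensional complex representation of `G`, in coordinates. -/
structure IrrepModel (G : Type*) [Group G] [TopologicalSpace G] where
  n : ℕ
  rep : Representation ℂ G (Fin n → ℂ)
  continuous_rep : rep.IsContinuousAction
  irreducible_rep : rep.IsIrreducible

/-- Isomorphism of representations. -/
instance IrrepModel.instSetoid (G : Type*) [Group G] [TopologicalSpace G] :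
    Setoid (IrrepModel G) where
  r σ ρ := Nonempty (σ.rep.Equiv ρ.rep)
  iseqv :=
    { refl := fun _ => ⟨Representation.Equiv.refl _⟩
      symm := fun ⟨e⟩ => ⟨e.symm⟩
      trans := fun ⟨e⟩ ⟨f⟩ => ⟨e.trans f⟩ }

/-- The isomorphism classes of continuous irreducible finite-dimensional complex representations
of `G`. -/
def Irr (G : Type*) [Group G] [TopologicalSpace G] : Type _ :=
  Quotient (IrrepModel.instSetoid G)

namespace Irr

variable {G : Type*} [Group G] [TopologicalSpace G]

/-- The character of an isomorphism class of irreducible representations. -/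
def char (φ : Irr G) : G → ℂ :=
  Quotient.lift (fun σ : IrrepModel G => σ.rep.character)
    (by
      rintro _ _ ⟨e⟩
      exact Representation.char_iso e) φ

/-- The dimension of an isomorphism class of irreducible representations. -/
def dim (φ : Irr G) : ℕ :=
  Quotient.lift (fun σ : IrrepModel G => Module.finrank ℂ (Fin σ.n → ℂ))
    (by
      rintro _ _ ⟨e⟩
      exact e.toLinearEquiv.finrank_eq) φ

/-- The character ratio of `φ` at `α`. -/
def charRatio (φ : Irr G) (α : G) : ℂ := φ.char α / (φ.dim : ℂ)

/-- The class of the trivial representation: every group element acts as the identity. -/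
def IsTriv (φ : Irr G) : Prop :=
  Quotient.lift (fun σ : IrrepModel G => ∀ g v, σ.rep g v = v)
    (by
      have key : ∀ σ ρ : IrrepModel G, σ.rep.Equiv ρ.rep →
          (∀ g v, σ.rep g v = v) → ∀ g v, ρ.rep g v = v := by
        intro σ ρ e h g v
        have h1 := LinearMap.congr_fun (e.symm.toIntertwiningMap.isIntertwining' g) v
        apply e.symm.toLinearEquiv.injective
        exact h1.trans (h g _)
      rintro σ ρ ⟨e⟩
      exact propext ⟨key σ ρ e, key ρ σ e.symm⟩) φ

/-- The multiplicity of `φ` in the representation `ρ`. -/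
def mult {W : Type*} [AddCommGroup W] [Module ℂ W] (φ : Irr G) (ρ : Representation ℂ G W) : ℕ :=
  Quotient.lift (fun σ : IrrepModel G => σ.rep.multiplicity ρ)
    (by
      rintro σ σ' ⟨e⟩
      refine LinearEquiv.finrank_eq
        (LinearEquiv.ofLinearMap
          { toFun := fun f => f.comp e.symm.toIntertwiningMap
            map_add' := fun _ _ => rfl
            map_smul' := fun _ _ => rfl }
          { toFun := fun f => f.comp e.toIntertwiningMap
            map_add' := fun _ _ => rfl
            map_smul' := fun _ _ => rfl } ?_ ?_)
      · apply LinearMap.ext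
        intro f
        apply Representation.IntertwiningMap.ext
        apply LinearMap.ext
        intro v
        exact congrArg (fun x => f x) (e.toLinearEquiv.apply_symm_apply v)
      · apply LinearMap.ext
        intro f
        apply Representation.IntertwiningMap.ext
        apply LinearMap.ext
        intro v
        exact congrArg (fun x => f x) (e.toLinearEquiv.symm_apply_apply v)) φ

end Irr

/-- The representation `(τ + τ̄)²`, i.e. `(τ ⊕ τ̄) ⊗ (τ ⊕ τ̄)`. -/
def Representation.sumConjSq {G V : Type*} [Monoid G] [AddCommGroup V] [Module ℂ V]
    (τ : Representation ℂ G V) :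
    Representation ℂ G ((V × ConjSpace V) ⊗[ℂ] (V × ConjSpace V)) :=
  (τ.prod τ.conjRep).tprod (τ.prod τ.conjRep)

/-- The random variable `W(g) = (χ(g) + conj χ(g)) / √2`, with values in the reals. -/
def Representation.symmTrace {G V : Type*} [Monoid G] [AddCommGroup V] [Module ℂ V]
    (τ : Representation ℂ G V) (g : G) : ℝ :=
  (τ.character g + conj (τ.character g)).re / √2

end

/-! The proof is Stein's method with an exchangeable pair. Take g and h independent and Haar
distributed, X = W(g) and Y = W(g·hαh⁻¹). Since α and α⁻¹ are conjugate, (X, Y) is exchangeable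
(`integral_conj_exchange`). By Schur's lemma the average of τ(hαh⁻¹) over h is the scalar χ^τ(α)/dim
τ = 1 - a, so E[Y | g] = (1 - a)X. As χ^τ is not real valued, E X² = 1, and hence E(Y - X)² = 2a
(`isSteinPair_symmTrace`).

For any such pair, Stein's equation, solved for a linear ramp in place of the indicator of a
half-line, bounds the Kolmogorov distance by a term measuring how far E[(Y - X)² | g]/(2a) is from
1, plus L·E|Y - X|³/(4a) + 1/(L√(2π)), where -L is the slope of the ramp. Estimating the third
moment by the second and fourth and choosing L well produces the fourth root
(`abs_measureReal_sub_gaussCDF_le_fourth`).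

Both terms are then computed with characters. W² = ½ Σ m_φ χ^φ, and averaging over h multiplies χ^φ
by its character ratio at α. So 1 - E[(Y - X)² | g]/(2a) is a finite combination of irreducible
characters in which the trivial one cancels; its L² norm gives the starred sum. Orthonormality also
gives E X⁴ and E X²Y², which determine E(Y - X)⁴ (`integral_pow_four`). The required character
theory (`integral_character_mul_conj`, `exists_finset_character_eq`) comes from averaging over Haar
measure. -/

section SteinMethod

open MeasureTheory Set Filter Topology

/-! ### Gaussian integrals -/

section Gaussian

theorem exp_sq_half_mul_exp_neg_sq_half (w : ℝ) :
    Real.exp (w ^ 2 / 2) * Real.exp (-w ^ 2 / 2) = 1 := by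
  rw [← Real.exp_add, ← Real.exp_zero]
  congr 1
  ring

theorem integrable_exp_neg_sq_half : Integrable fun t : ℝ => Real.exp (-t ^ 2 / 2) := by
  have h := integrable_exp_neg_mul_sq (b := 1 / 2) (by norm_num)
  refine h.congr (ae_of_all _ fun t => ?_)
  dsimp only
  congr 1
  ring

theorem integrable_id_mul_exp_neg_sq_half :
    Integrable fun t : ℝ => t * Real.exp (-t ^ 2 / 2) := by
  have h := integrable_mul_exp_neg_mul_sq (b := 1 / 2) (by norm_num)
  refine h.congr (ae_of_all _ fun t => ?_)
  dsimp only
  congr 2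
  ring

theorem integrable_sq_mul_exp_neg_sq_half :
    Integrable fun t : ℝ => t ^ 2 * Real.exp (-t ^ 2 / 2) := by
  have h := integrable_rpow_mul_exp_neg_mul_sq (b := 1 / 2) (by norm_num) (s := 2) (by norm_num)
  refine h.congr (ae_of_all _ fun t => ?_)
  dsimp only
  rw [Real.rpow_two]
  congr 2
  ring

theorem integrable_sub_sq_mul_exp_neg_sq_half (w : ℝ) :
    Integrable fun t : ℝ => ((t - w) ^ 2 - (1 + w ^ 2)) * Real.exp (-t ^ 2 / 2) := by
  have := (integrable_sq_mul_exp_neg_sq_half.sub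
    (integrable_id_mul_exp_neg_sq_half.const_mul (2 * w))).sub integrable_exp_neg_sq_half
  refine this.congr (ae_of_all _ fun t => ?_)
  simp only [Pi.sub_apply]
  ring

theorem integral_exp_neg_sq_half : ∫ t : ℝ, Real.exp (-t ^ 2 / 2) = √(2 * Real.pi) := by
  have h := integral_gaussian (1 / 2)
  rw [show Real.pi / (1 / 2) = 2 * Real.pi by ring] at h
  rw [← h]
  congr 1
  ext t
  congr 1
  ring

theorem hasDerivAt_exp_neg_sq_half (t : ℝ) :
    HasDerivAt (fun t : ℝ => Real.exp (-t ^ 2 / 2)) (-t * Real.exp (-t ^ 2 / 2)) t := by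
  have h : HasDerivAt (fun t : ℝ => -t ^ 2 / 2) (-t) t := by
    have := ((hasDerivAt_pow 2 t).neg).div_const 2
    convert! this using 1
    simp
    ring
  convert! h.exp using 1
  ring

theorem integral_Ioi_id_mul_exp_neg_sq_half (w : ℝ) :
    ∫ t in Ioi w, t * Real.exp (-t ^ 2 / 2) = Real.exp (-w ^ 2 / 2) := by
  have hd : ∀ t ∈ Ici w, HasDerivAt (fun t : ℝ => -Real.exp (-t ^ 2 / 2))
      (t * Real.exp (-t ^ 2 / 2)) t := fun t _ => by
    convert! (hasDerivAt_exp_neg_sq_half t).neg using 1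
    ring
  have ht := tendsto_zero_of_hasDerivAt_of_integrableOn_Ioi
    (fun t ht => hd t (Ioi_subset_Ici_self ht)) integrable_id_mul_exp_neg_sq_half.integrableOn
    integrable_exp_neg_sq_half.neg.integrableOn
  rw [integral_Ioi_of_hasDerivAt_of_tendsto' hd integrable_id_mul_exp_neg_sq_half.integrableOn ht]
  ring

theorem integral_Ioi_sub_sq_mul_exp_neg_sq_half (w : ℝ) :
    ∫ t in Ioi w, ((t - w) ^ 2 - (1 + w ^ 2)) * Real.exp (-t ^ 2 / 2)
      = -w * Real.exp (-w ^ 2 / 2) := by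
  have hd : ∀ t ∈ Ici w, HasDerivAt (fun t : ℝ => (2 * w - t) * Real.exp (-t ^ 2 / 2))
      (((t - w) ^ 2 - (1 + w ^ 2)) * Real.exp (-t ^ 2 / 2)) t := fun t _ => by
    convert! ((hasDerivAt_id t).const_sub (2 * w)).mul (hasDerivAt_exp_neg_sq_half t) using 1
    simp only [id]
    ring
  have hi := integrable_sub_sq_mul_exp_neg_sq_half w
  have hi' : Integrable fun t : ℝ => (2 * w - t) * Real.exp (-t ^ 2 / 2) := by
    have := (integrable_exp_neg_sq_half.const_mul (2 * w)).sub integrable_id_mul_exp_neg_sq_half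
    refine this.congr (ae_of_all _ fun t => ?_)
    simp only [Pi.sub_apply]
    ring
  have ht := tendsto_zero_of_hasDerivAt_of_integrableOn_Ioi
    (fun t ht => hd t (Ioi_subset_Ici_self ht)) hi.integrableOn hi'.integrableOn
  rw [integral_Ioi_of_hasDerivAt_of_tendsto' hd hi.integrableOn ht]
  ring

/-- Upper Mills ratio bound: on the ray w may be replaced by t, and t·exp(-t²/2) integrates exactly.
-/
theorem mul_integral_Ioi_exp_neg_sq_half_le (w : ℝ) :
    w * ∫ t in Ioi w, Real.exp (-t ^ 2 / 2) ≤ Real.exp (-w ^ 2 / 2) := by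
  rw [← integral_Ioi_id_mul_exp_neg_sq_half, ← integral_const_mul]
  refine setIntegral_mono_on (integrable_exp_neg_sq_half.const_mul w).integrableOn
    integrable_id_mul_exp_neg_sq_half.integrableOn measurableSet_Ioi fun t ht => ?_
  exact mul_le_mul_of_nonneg_right (le_of_lt ht) (Real.exp_pos _).le

/-- Lower Mills ratio bound: drop the nonnegative (t - w)² from the exact integral above. -/
theorem mul_exp_neg_sq_half_le_integral_Ioi (w : ℝ) :
    w * Real.exp (-w ^ 2 / 2) ≤ (1 + w ^ 2) * ∫ t in Ioi w, Real.exp (-t ^ 2 / 2) := by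
  have hi := integrable_sub_sq_mul_exp_neg_sq_half w
  have h : -((1 + w ^ 2) * ∫ t in Ioi w, Real.exp (-t ^ 2 / 2)) ≤ -w * Real.exp (-w ^ 2 / 2) := by
    rw [← integral_Ioi_sub_sq_mul_exp_neg_sq_half, ← neg_mul, ← integral_const_mul]
    refine setIntegral_mono_on (integrable_exp_neg_sq_half.const_mul _).integrableOn
      hi.integrableOn measurableSet_Ioi fun t _ => ?_
    exact mul_le_mul_of_nonneg_right (by nlinarith [sq_nonneg (t - w)]) (Real.exp_pos _).le
  linarith

end Gaussian

/-! ### The solution of Stein's equation -/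

section SteinEquation

/-- The solution `f` of Stein's equation `f' w - w * f w = k w`. -/
noncomputable def steinSol (k : ℝ → ℝ) (w : ℝ) : ℝ :=
  Real.exp (w ^ 2 / 2) * ∫ t in Iic w, k t * Real.exp (-t ^ 2 / 2)

/-- Continuous functions which are integrable with mean zero for the standard Gaussian. -/
structure GaussCentered (k : ℝ → ℝ) : Prop where
  continuous : Continuous k
  integrable : Integrable fun t => k t * Real.exp (-t ^ 2 / 2)
  integral_eq : ∫ t, k t * Real.exp (-t ^ 2 / 2) = 0

variable {k : ℝ → ℝ}

theorem GaussCentered.hasDerivAt_steinSol (hk : GaussCentered k) (w : ℝ) :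
    HasDerivAt (steinSol k) (w * steinSol k w + k w) w := by
  have hc : Continuous fun t => k t * Real.exp (-t ^ 2 / 2) := by
    have := hk.continuous
    fun_prop
  have h1 : HasDerivAt (fun w => ∫ t in Iic w, k t * Real.exp (-t ^ 2 / 2))
      (k w * Real.exp (-w ^ 2 / 2)) w := by
    have h2 : (fun w => ∫ t in Iic w, k t * Real.exp (-t ^ 2 / 2)) = fun w =>
        (∫ t in (0 : ℝ)..w, k t * Real.exp (-t ^ 2 / 2))
          + ∫ t in Iic 0, k t * Real.exp (-t ^ 2 / 2) := by
      ext w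
      rw [← intervalIntegral.integral_Iic_sub_Iic hk.integrable.integrableOn
        hk.integrable.integrableOn]
      ring
    rw [h2]
    exact (intervalIntegral.integral_hasDerivAt_right (hc.intervalIntegrable _ _)
      hc.stronglyMeasurable.stronglyMeasurableAtFilter hc.continuousAt).add_const _
  have h2 : HasDerivAt (fun w : ℝ => Real.exp (w ^ 2 / 2)) (Real.exp (w ^ 2 / 2) * w) w := by
    have h : HasDerivAt (fun t : ℝ => t ^ 2 / 2) w w := by
      convert! (hasDerivAt_pow 2 w).div_const 2 using 1
      simp
    exact h.exp
  have h3 := h2.mul h1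
  have h4 := exp_sq_half_mul_exp_neg_sq_half w
  convert! h3 using 1
  rw [steinSol]
  linear_combination -(k w) * h4

/-- Mean zero trades the lower tail for the upper one, where the Mills bounds apply for w ≥ 0. -/
theorem GaussCentered.steinSol_eq (hk : GaussCentered k) (w : ℝ) :
    steinSol k w = -(Real.exp (w ^ 2 / 2) * ∫ t in Ioi w, k t * Real.exp (-t ^ 2 / 2)) := by
  have h := intervalIntegral.integral_Iic_add_Ioi (b := w) hk.integrable.integrableOn
    hk.integrable.integrableOn
  rw [hk.integral_eq] at h
  rw [steinSol]
  linear_combination Real.exp (w ^ 2 / 2) * h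

theorem GaussCentered.reflect (hk : GaussCentered k) : GaussCentered fun x => -k (-x) where
  continuous := (hk.continuous.comp continuous_neg).neg
  integrable := by
    refine hk.integrable.comp_neg.neg.congr (ae_of_all _ fun t => ?_)
    simp
  integral_eq := by
    have h := integral_neg_eq_self (fun t => k t * Real.exp (-t ^ 2 / 2)) volume
    rw [hk.integral_eq] at h
    simp only [neg_mul, integral_neg, neg_eq_zero]
    simpa using h

/-- This symmetry reduces the estimates below to w ≥ 0. -/
theorem GaussCentered.steinSol_reflect (hk : GaussCentered k) (w : ℝ) :
    steinSol (fun x => -k (-x)) w = steinSol k (-w) := by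
  rw [hk.steinSol_eq, steinSol]
  have h := integral_comp_neg_Iic w fun t => k t * Real.exp (-t ^ 2 / 2)
  simp only [neg_mul, integral_neg, ← h]
  simp

theorem GaussCentered.abs_mul_steinSol_le (hk : GaussCentered k) {C : ℝ}
    (hC : ∀ x, |k x| ≤ C) (w : ℝ) : |w * steinSol k w| ≤ C := by
  have key : ∀ {k : ℝ → ℝ}, GaussCentered k → (∀ x, |k x| ≤ C) → ∀ w, 0 ≤ w →
      |w * steinSol k w| ≤ C := by
    intro k hk hC w hw
    have hC0 : 0 ≤ C := (abs_nonneg _).trans (hC 0)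
    have h1 : |∫ t in Ioi w, k t * Real.exp (-t ^ 2 / 2)|
        ≤ C * ∫ t in Ioi w, Real.exp (-t ^ 2 / 2) := by
      rw [← integral_const_mul, ← Real.norm_eq_abs]
      refine norm_integral_le_of_norm_le (integrable_exp_neg_sq_half.const_mul C).integrableOn
        (ae_of_all _ fun t => ?_)
      rw [norm_mul, Real.norm_eq_abs, Real.norm_eq_abs, Real.abs_exp]
      exact mul_le_mul_of_nonneg_right (hC t) (Real.exp_pos _).le
    have h4 := exp_sq_half_mul_exp_neg_sq_half w
    rw [hk.steinSol_eq, abs_mul, abs_neg, abs_mul, abs_of_nonneg hw, Real.abs_exp]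
    calc w * (Real.exp (w ^ 2 / 2) * |∫ t in Ioi w, k t * Real.exp (-t ^ 2 / 2)|)
        ≤ w * (Real.exp (w ^ 2 / 2) * (C * ∫ t in Ioi w, Real.exp (-t ^ 2 / 2))) := by gcongr
      _ = C * (Real.exp (w ^ 2 / 2) * (w * ∫ t in Ioi w, Real.exp (-t ^ 2 / 2))) := by ring
      _ ≤ C * (Real.exp (w ^ 2 / 2) * Real.exp (-w ^ 2 / 2)) := by
        gcongr
        exact mul_integral_Ioi_exp_neg_sq_half_le w
      _ = C := by rw [h4, mul_one]
  rcases le_total 0 w with hw | hw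
  · exact key hk hC w hw
  · have h := key hk.reflect (fun x => by rw [abs_neg]; exact hC _) (-w) (by linarith)
    rwa [hk.steinSol_reflect, neg_neg, neg_mul, abs_neg] at h

/-- The quantity is the derivative of w·f(w). For w ≥ 0: if k w ≥ 0, then k ≥ 0 to the left of w and
f w ≥ 0; otherwise k ≤ k w ≤ 0 on the upper tail and the lower Mills bound applies. -/
theorem GaussCentered.deriv_mul_steinSol_nonneg (hk : GaussCentered k) (hanti : Antitone k)
    (w : ℝ) : 0 ≤ (1 + w ^ 2) * steinSol k w + w * k w := by
  have key : ∀ {k : ℝ → ℝ}, GaussCentered k → Antitone k → ∀ w, 0 ≤ w →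
      0 ≤ (1 + w ^ 2) * steinSol k w + w * k w := by
    intro k hk hanti w hw
    rcases le_total 0 (k w) with h | h
    · have : 0 ≤ steinSol k w := by
        refine mul_nonneg (Real.exp_pos _).le (setIntegral_nonneg measurableSet_Iic fun t ht => ?_)
        exact mul_nonneg (h.trans (hanti ht)) (Real.exp_pos _).le
      positivity
    · have h1 : ∫ t in Ioi w, k t * Real.exp (-t ^ 2 / 2)
          ≤ k w * ∫ t in Ioi w, Real.exp (-t ^ 2 / 2) := by
        rw [← integral_const_mul]
        refine setIntegral_mono_on hk.integrable.integrableOn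
          (integrable_exp_neg_sq_half.const_mul _).integrableOn measurableSet_Ioi fun t ht => ?_
        exact mul_le_mul_of_nonneg_right (hanti (le_of_lt ht)) (Real.exp_pos _).le
      have h2 := mul_exp_neg_sq_half_le_integral_Ioi w
      have h4 := exp_sq_half_mul_exp_neg_sq_half w
      set J := ∫ t in Ioi w, Real.exp (-t ^ 2 / 2)
      set I := ∫ t in Ioi w, k t * Real.exp (-t ^ 2 / 2)
      have h5 : (1 + w ^ 2) * I ≤ k w * (w * Real.exp (-w ^ 2 / 2)) := by
        calc (1 + w ^ 2) * I ≤ (1 + w ^ 2) * (k w * J) := by gcongr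
          _ = k w * ((1 + w ^ 2) * J) := by ring
          _ ≤ _ := mul_le_mul_of_nonpos_left h2 h
      have h6 := mul_le_mul_of_nonneg_left h5 (Real.exp_pos (w ^ 2 / 2)).le
      have h7 : Real.exp (w ^ 2 / 2) * (k w * (w * Real.exp (-w ^ 2 / 2))) = w * k w := by
        linear_combination (k w * w) * h4
      rw [hk.steinSol_eq]
      rw [h7] at h6
      linarith
  rcases le_total 0 w with hw | hw
  · exact key hk hanti w hw
  · have h := key hk.reflect (fun x y hxy => neg_le_neg (hanti (neg_le_neg hxy))) (-w)
      (by linarith)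
    rw [hk.steinSol_reflect, neg_neg, neg_sq] at h
    linarith

theorem GaussCentered.monotone_mul_steinSol (hk : GaussCentered k) (hanti : Antitone k) :
    Monotone fun w => w * steinSol k w := by
  have hd : ∀ w, HasDerivAt (fun w => w * steinSol k w)
      ((1 + w ^ 2) * steinSol k w + w * k w) w := fun w => by
    convert! (hasDerivAt_id w).mul (hk.hasDerivAt_steinSol w) using 1
    simp only [id]
    ring
  refine monotone_of_deriv_nonneg (fun w => (hd w).differentiableAt) fun w => ?_
  rw [(hd w).deriv]
  exact hk.deriv_mul_steinSol_nonneg hanti w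

theorem gaussCentered_neg_mul (L : ℝ) : GaussCentered fun x => -(L * x) where
  continuous := by fun_prop
  integrable := by
    refine (integrable_id_mul_exp_neg_sq_half.const_mul (-L)).congr (ae_of_all _ fun t => ?_)
    dsimp only
    ring
  integral_eq := by
    have h := integral_neg_eq_self (fun t : ℝ => t * Real.exp (-t ^ 2 / 2)) volume
    simp only [neg_sq, neg_mul, integral_neg] at h
    have h0 : ∫ t : ℝ, t * Real.exp (-t ^ 2 / 2) = 0 := by linarith
    simp only [neg_mul, mul_assoc, integral_neg, integral_const_mul, h0, mul_zero, neg_zero]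

theorem steinSol_neg_mul (L w : ℝ) : steinSol (fun x => -(L * x)) w = L := by
  rw [(gaussCentered_neg_mul L).steinSol_eq]
  simp only [neg_mul, mul_assoc, integral_neg, integral_const_mul,
    integral_Ioi_id_mul_exp_neg_sq_half]
  have h4 := exp_sq_half_mul_exp_neg_sq_half w
  linear_combination L * h4

theorem GaussCentered.sub {l : ℝ → ℝ} (hk : GaussCentered k) (hl : GaussCentered l) :
    GaussCentered fun x => k x - l x where
  continuous := hk.continuous.sub hl.continuous
  integrable := by
    simp only [sub_mul]
    exact hk.integrable.sub hl.integrable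
  integral_eq := by
    simp only [sub_mul]
    rw [integral_sub hk.integrable hl.integrable, hk.integral_eq, hl.integral_eq, sub_zero]

theorem GaussCentered.steinSol_sub {l : ℝ → ℝ} (hk : GaussCentered k) (hl : GaussCentered l)
    (w : ℝ) : steinSol (fun x => k x - l x) w = steinSol k w - steinSol l w := by
  simp only [steinSol, sub_mul]
  rw [integral_sub hk.integrable.integrableOn hl.integrable.integrableOn]
  ring

/-- For -(L * x) the solution is the constant L. By linearity, monotonicity for the difference says
that w·(L - f w) increases. -/
theorem GaussCentered.mul_steinSol_sub_le (hk : GaussCentered k) {L : ℝ}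
    (hL : Antitone fun x => -(L * x) - k x) {w w' : ℝ} (h : w ≤ w') :
    w' * steinSol k w' - w * steinSol k w ≤ L * (w' - w) := by
  have h1 := ((gaussCentered_neg_mul L).sub hk).monotone_mul_steinSol hL h
  simp only [(gaussCentered_neg_mul L).steinSol_sub hk, steinSol_neg_mul] at h1
  linarith

/-- In f' = w·f + k the first summand increases and the second decreases, each by at most L times
the step. The increments have opposite signs, so the Lipschitz constant is L and not 2L. -/
theorem GaussCentered.abs_deriv_steinSol_sub_le (hk : GaussCentered k) {L : ℝ}
    (hanti : Antitone k) (hL : Antitone fun x => -(L * x) - k x) (w w' : ℝ) :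
    |(w' * steinSol k w' + k w') - (w * steinSol k w + k w)| ≤ L * |w' - w| := by
  have key : ∀ {w w' : ℝ}, w ≤ w' →
      |(w' * steinSol k w' + k w') - (w * steinSol k w + k w)| ≤ L * (w' - w) := by
    intro w w' h
    have h1 := hk.mul_steinSol_sub_le hL h
    have h2 := hk.monotone_mul_steinSol hanti h
    have h3 := hanti h
    have h4 := hL h
    dsimp only at h2 h4
    rw [abs_le]
    constructor <;> linarith
  rcases le_total w w' with h | h
  · rw [abs_of_nonneg (sub_nonneg.2 h)]
    exact key h
  · rw [abs_sub_comm, abs_sub_comm w', abs_of_nonneg (sub_nonneg.2 h)]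
    exact key h

theorem GaussCentered.continuous_steinSol (hk : GaussCentered k) : Continuous (steinSol k) :=
  continuous_iff_continuousAt.2 fun w => (hk.hasDerivAt_steinSol w).continuousAt

theorem abs_sub_sub_mul_le_of_lipschitz_deriv {f f' : ℝ → ℝ} {L : ℝ}
    (hf : ∀ w, HasDerivAt f (f' w) w) (hL : ∀ w w', |f' w' - f' w| ≤ L * |w' - w|)
    (hc : Continuous f') (w w' : ℝ) :
    |f w' - f w - (w' - w) * f' w| ≤ L * (w' - w) ^ 2 / 2 := by
  set D := w' - w with hD
  have h1 : ∀ s : ℝ, HasDerivAt (fun s => f (w + s * D) - s * (D * f' w))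
      (D * (f' (w + s * D) - f' w)) s := fun s => by
    have h2 : HasDerivAt (fun s => w + s * D) D s := by
      simpa using ((hasDerivAt_id s).mul_const D).const_add w
    have h3 := ((hf (w + s * D)).comp s h2).sub ((hasDerivAt_id s).mul_const (D * f' w))
    convert! h3 using 1
    ring
  have h2 : ∫ s in (0 : ℝ)..1, D * (f' (w + s * D) - f' w) = f w' - f w - D * f' w := by
    rw [intervalIntegral.integral_eq_sub_of_hasDerivAt (fun s _ => h1 s)
      (Continuous.intervalIntegrable (by fun_prop) _ _)]
    simp only [hD]
    ring_nf
  rw [← h2, ← Real.norm_eq_abs]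
  have h3 : ∫ s in (0 : ℝ)..1, (L * D ^ 2) * s = L * D ^ 2 / 2 := by
    rw [intervalIntegral.integral_const_mul, integral_id]
    ring
  rw [← h3]
  refine intervalIntegral.norm_integral_le_of_norm_le zero_le_one (ae_of_all _ fun s hs => ?_)
    (Continuous.intervalIntegrable (by fun_prop) _ _)
  rw [Real.norm_eq_abs, abs_mul]
  have h4 := hL w (w + s * D)
  rw [add_sub_cancel_left, abs_mul, abs_of_pos hs.1] at h4
  calc |D| * |f' (w + s * D) - f' w| ≤ |D| * (L * (s * |D|)) := by gcongr
    _ = L * |D| ^ 2 * s := by ring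
    _ = L * D ^ 2 * s := by rw [sq_abs]

end SteinEquation

/-! ### Linear ramps -/

section Ramp

/-- The function which is `1` up to `s` and then decreases to `0` with slope `-L`. -/
noncomputable def ramp (L s x : ℝ) : ℝ := max 0 (min 1 (1 - L * (x - s)))

variable {L : ℝ}

theorem continuous_ramp (L s : ℝ) : Continuous (ramp L s) := by
  unfold ramp
  fun_prop

theorem ramp_nonneg (L s x : ℝ) : 0 ≤ ramp L s x := le_max_left _ _

theorem ramp_le_one (L s x : ℝ) : ramp L s x ≤ 1 := max_le zero_le_one (min_le_left _ _)

theorem antitone_ramp (hL : 0 ≤ L) (s : ℝ) : Antitone (ramp L s) := fun x y hxy => by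
  have : L * x ≤ L * y := mul_le_mul_of_nonneg_left hxy hL
  exact max_le_max le_rfl (min_le_min le_rfl (by linarith))

/-- The ramp nowhere falls faster than slope -L; this is the form needed by
`abs_deriv_steinSol_sub_le`. -/
theorem antitone_neg_mul_sub_ramp (hL : 0 ≤ L) (s : ℝ) :
    Antitone fun x => -(L * x) - ramp L s x := fun x y hxy => by
  have : L * x ≤ L * y := mul_le_mul_of_nonneg_left hxy hL
  have h : ramp L s x ≤ ramp L s y + L * (y - x) := by
    refine max_le (add_nonneg (ramp_nonneg _ _ _) (by linarith)) ?_
    rcases le_total 1 (1 - L * (y - s)) with h | h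
    · have : ramp L s y = 1 := by
        rw [ramp, min_eq_left h, max_eq_right zero_le_one]
      rw [this]
      exact (min_le_left _ _).trans (by linarith)
    · have h1 : 1 - L * (y - s) ≤ ramp L s y := by
        rw [ramp, min_eq_right h]
        exact le_max_right _ _
      exact (min_le_right _ _).trans (by linarith)
  dsimp only
  linarith

theorem ramp_eq_one (hL : 0 ≤ L) {s x : ℝ} (h : x ≤ s) : ramp L s x = 1 := by
  have : L * (x - s) ≤ 0 := mul_nonpos_of_nonneg_of_nonpos hL (by linarith)
  rw [ramp, min_eq_left (by linarith), max_eq_right zero_le_one]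

theorem ramp_eq_zero (hL : 0 < L) {s x : ℝ} (h : s + 1 / L ≤ x) : ramp L s x = 0 := by
  have : 1 ≤ L * (x - s) := by
    rw [mul_comm, ← div_le_iff₀ hL]
    linarith
  rw [ramp, max_eq_left]
  exact (min_le_right _ _).trans (by linarith)

theorem indicator_Iic_le_ramp (hL : 0 ≤ L) (s x : ℝ) :
    (Iic s).indicator (fun _ => (1 : ℝ)) x ≤ ramp L s x := by
  by_cases h : x ≤ s
  · rw [indicator_of_mem (show x ∈ Iic s from h), ramp_eq_one hL h]
  · rw [indicator_of_notMem (show x ∉ Iic s from h)]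
    exact ramp_nonneg _ _ _

theorem ramp_le_indicator_Iic (hL : 0 < L) (s x : ℝ) :
    ramp L s x ≤ (Iic (s + 1 / L)).indicator (fun _ => (1 : ℝ)) x := by
  by_cases h : x ≤ s + 1 / L
  · rw [indicator_of_mem (show x ∈ Iic _ from h)]
    exact ramp_le_one _ _ _
  · rw [indicator_of_notMem (show x ∉ Iic _ from h), ramp_eq_zero hL (le_of_not_ge h)]

/-- The expectation of `h` for the standard Gaussian. -/
noncomputable def gaussMean (h : ℝ → ℝ) : ℝ :=
  1 / √(2 * Real.pi) * ∫ x, h x * Real.exp (-x ^ 2 / 2)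

theorem integrable_ramp_mul (L s : ℝ) :
    Integrable fun x => ramp L s x * Real.exp (-x ^ 2 / 2) :=
  integrable_exp_neg_sq_half.bdd_mul (c := 1) (continuous_ramp L s).aestronglyMeasurable
    (ae_of_all _ fun x => by
      rw [Real.norm_eq_abs, abs_of_nonneg (ramp_nonneg _ _ _)]
      exact ramp_le_one _ _ _)

theorem gaussMean_ramp_nonneg (L s : ℝ) : 0 ≤ gaussMean (ramp L s) :=
  mul_nonneg (by positivity)
    (integral_nonneg fun x => mul_nonneg (ramp_nonneg _ _ _) (Real.exp_pos _).le)

theorem gaussMean_ramp_le_one (L s : ℝ) : gaussMean (ramp L s) ≤ 1 := by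
  have hpos : 0 < √(2 * Real.pi) := Real.sqrt_pos.2 (by positivity)
  rw [gaussMean, one_div, inv_mul_le_iff₀ hpos, mul_one, ← integral_exp_neg_sq_half]
  refine integral_mono (integrable_ramp_mul L s) integrable_exp_neg_sq_half fun x => ?_
  exact mul_le_of_le_one_left (Real.exp_pos _).le (ramp_le_one _ _ _)

theorem gaussCentered_ramp_sub (L s : ℝ) :
    GaussCentered fun x => ramp L s x - gaussMean (ramp L s) where
  continuous := (continuous_ramp L s).sub continuous_const
  integrable := by
    simp only [sub_mul]
    exact (integrable_ramp_mul L s).sub (integrable_exp_neg_sq_half.const_mul _)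
  integral_eq := by
    have hpos : √(2 * Real.pi) ≠ 0 := (Real.sqrt_pos.2 (by positivity)).ne'
    simp only [sub_mul]
    rw [integral_sub (integrable_ramp_mul L s) (integrable_exp_neg_sq_half.const_mul _),
      integral_const_mul, integral_exp_neg_sq_half, gaussMean]
    field_simp
    ring

/-- The distribution function of the standard Gaussian. -/
noncomputable def gaussCDF (x : ℝ) : ℝ :=
  1 / √(2 * Real.pi) * ∫ t in Iic x, Real.exp (-t ^ 2 / 2)

theorem gaussCDF_le_gaussMean_ramp (hL : 0 ≤ L) (s : ℝ) :
    gaussCDF s ≤ gaussMean (ramp L s) := by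
  refine mul_le_mul_of_nonneg_left ?_ (by positivity)
  rw [← integral_indicator measurableSet_Iic]
  refine integral_mono (integrable_exp_neg_sq_half.indicator measurableSet_Iic)
    (integrable_ramp_mul L s) fun x => ?_
  have h := mul_le_mul_of_nonneg_right (indicator_Iic_le_ramp hL s x)
    (Real.exp_pos (-x ^ 2 / 2)).le
  simpa [indicator_apply, ite_mul] using h

theorem gaussMean_ramp_le_gaussCDF (hL : 0 < L) (s : ℝ) :
    gaussMean (ramp L s) ≤ gaussCDF (s + 1 / L) := by
  refine mul_le_mul_of_nonneg_left ?_ (by positivity)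
  rw [← integral_indicator measurableSet_Iic]
  refine integral_mono (integrable_ramp_mul L s)
    (integrable_exp_neg_sq_half.indicator measurableSet_Iic) fun x => ?_
  have h := mul_le_mul_of_nonneg_right (ramp_le_indicator_Iic hL s x)
    (Real.exp_pos (-x ^ 2 / 2)).le
  simpa [indicator_apply, ite_mul] using h

/-- The Gaussian density never exceeds 1/√(2π). -/
theorem gaussCDF_add_le (x : ℝ) {δ : ℝ} (hδ : 0 ≤ δ) :
    gaussCDF (x + δ) ≤ gaussCDF x + δ / √(2 * Real.pi) := by
  have h := intervalIntegral.integral_Iic_sub_Iic (a := x) (b := x + δ)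
    integrable_exp_neg_sq_half.integrableOn integrable_exp_neg_sq_half.integrableOn
  have h2 : ∫ t in x..(x + δ), Real.exp (-t ^ 2 / 2) ≤ ∫ _t in x..(x + δ), (1 : ℝ) := by
    refine intervalIntegral.integral_mono_on (by linarith)
      integrable_exp_neg_sq_half.intervalIntegrable (by simp) fun t _ => ?_
    rw [Real.exp_le_one_iff]
    nlinarith [sq_nonneg t]
  rw [intervalIntegral.integral_const, smul_eq_mul, mul_one, add_sub_cancel_left, ← h] at h2
  have h3 := mul_le_mul_of_nonneg_left h2
    (show 0 ≤ 1 / √(2 * Real.pi) by positivity)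
  have h4 : δ / √(2 * Real.pi) = 1 / √(2 * Real.pi) * δ := by ring
  rw [gaussCDF, gaussCDF, h4]
  linarith

end Ramp

/-! ### Normal approximation by exchangeable pairs -/

section ExchangeablePair

variable {Ω : Type*} [TopologicalSpace Ω] [CompactSpace Ω] [MeasurableSpace Ω] [BorelSpace Ω]

theorem Continuous.integrable_of_compactSpace {E : Type*} [NormedAddCommGroup E]
    {P : Measure Ω} [IsFiniteMeasure P] {f : Ω → E}
    (hf : Continuous f) : Integrable f P :=
  hf.integrable_of_hasCompactSupport (HasCompactSupport.of_compactSpace f)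

/-- A pair of continuous random variables on a compact probability space is a Stein pair of
parameter `a` if it is exchangeable, satisfies the linear regression property
`E[Y | X] = (1 - a) X`, and has `E[(Y - X)²] = 2a`. -/
structure IsSteinPair (P : Measure Ω) (X Y : Ω → ℝ) (a : ℝ) : Prop where
  continuous_fst : Continuous X
  continuous_snd : Continuous Y
  exchangeable : ∀ F : ℝ × ℝ → ℝ, Continuous F →
    ∫ p, F (X p, Y p) ∂P = ∫ p, F (Y p, X p) ∂P
  regression : ∀ f : ℝ → ℝ, Continuous f →
    ∫ p, f (X p) * (Y p - X p) ∂P = -a * ∫ p, f (X p) * X p ∂P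
  integral_sq : ∫ p, (Y p - X p) ^ 2 ∂P = 2 * a

variable {P : Measure Ω} [IsProbabilityMeasure P] {X Y : Ω → ℝ} {a A : ℝ}

/-- The antisymmetric function (Y - X)(f(Y) + f(X)) has mean zero by exchangeability; the regression
property evaluates what remains. -/
theorem IsSteinPair.integral_sub_mul_sub (h : IsSteinPair P X Y a) {f : ℝ → ℝ}
    (hf : Continuous f) :
    ∫ p, (Y p - X p) * (f (Y p) - f (X p)) ∂P = 2 * a * ∫ p, f (X p) * X p ∂P := by
  have hX := h.continuous_fst
  have hY := h.continuous_snd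
  have h1 := h.exchangeable (fun p => (p.2 - p.1) * (f p.2 + f p.1)) (by fun_prop)
  have h2 : ∫ p, (X p - Y p) * (f (X p) + f (Y p)) ∂P
      = -∫ p, (Y p - X p) * (f (Y p) + f (X p)) ∂P := by
    rw [← integral_neg]
    congr 1
    ext p
    ring
  dsimp only at h1
  rw [h2] at h1
  have h3 : ∫ p, (Y p - X p) * (f (Y p) - f (X p)) ∂P
      = ∫ p, (Y p - X p) * (f (Y p) + f (X p)) ∂P - 2 * ∫ p, f (X p) * (Y p - X p) ∂P := by
    rw [← integral_const_mul, ← integral_sub]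
    · congr 1
      ext p
      ring
    · exact Continuous.integrable_of_compactSpace (by fun_prop)
    · exact Continuous.integrable_of_compactSpace (by fun_prop)
  rw [h3, h.regression f hf]
  linarith

/-- Hypothesis `hA` controls 1 - E[(Y - X)² | X]/(2a) by testing against bounded functions, which
avoids conditional expectations. -/
theorem IsSteinPair.abs_integral_ramp_sub_le (h : IsSteinPair P X Y a) (ha : 0 < a)
    (hA : ∀ φ : ℝ → ℝ, Continuous φ → (∀ x, |φ x| ≤ 2) →
      |∫ p, φ (X p) * (1 - (Y p - X p) ^ 2 / (2 * a)) ∂P| ≤ 2 * A) {L : ℝ} (hL : 0 ≤ L) (s : ℝ) :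
    |∫ p, ramp L s (X p) ∂P - gaussMean (ramp L s)|
      ≤ 2 * A + L * (∫ p, |Y p - X p| ^ 3 ∂P) / (4 * a) := by
  have hX := h.continuous_fst
  have hY := h.continuous_snd
  set N := gaussMean (ramp L s) with hN
  set k : ℝ → ℝ := fun x => ramp L s x - N with hk_def
  have hk : GaussCentered k := gaussCentered_ramp_sub L s
  have hkc := hk.continuous
  have hk1 : ∀ x, |k x| ≤ 1 := fun x => by
    have h1 := ramp_nonneg L s x
    have h2 := ramp_le_one L s x
    have h3 := gaussMean_ramp_nonneg L s
    have h4 := gaussMean_ramp_le_one L s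
    rw [abs_le]
    constructor <;> simp only [hk_def, hN] <;> linarith
  have hanti : Antitone k := fun x y hxy => by
    have := antitone_ramp hL s hxy
    simp only [hk_def]
    linarith
  have hLk : Antitone fun x => -(L * x) - k x := fun x y hxy => by
    have := antitone_neg_mul_sub_ramp hL s hxy
    simp only [hk_def] at this ⊢
    linarith
  set f := steinSol k with hf_def
  set f' : ℝ → ℝ := fun w => w * f w + k w with hf'_def
  have hfc : Continuous f := hk.continuous_steinSol
  have hf'c : Continuous f' := by fun_prop
  have hder : ∀ w, HasDerivAt f (f' w) w := hk.hasDerivAt_steinSol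
  have hf'2 : ∀ w, |f' w| ≤ 2 := fun w => by
    have h1 := abs_add_le (w * f w) (k w)
    have h2 := hk.abs_mul_steinSol_le hk1 w
    have h3 := hk1 w
    linarith
  have htaylor := abs_sub_sub_mul_le_of_lipschitz_deriv hder
    (hk.abs_deriv_steinSol_sub_le hanti hLk) hf'c
  -- Stein's equation gives E k(X) = E f'(X) - E X f(X), and E X f(X) = E (Y - X)(f(Y) - f(X))/(2a).
  -- Splitting off the first-order Taylor term of f leaves the remainder in the second integral.
  have h1 : ∫ p, ramp L s (X p) ∂P - N
      = ∫ p, f' (X p) * (1 - (Y p - X p) ^ 2 / (2 * a)) ∂P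
        - ∫ p, (Y p - X p) * (f (Y p) - f (X p) - (Y p - X p) * f' (X p)) / (2 * a) ∂P := by
    have h2 := h.integral_sub_mul_sub hfc
    have h3 : ∫ p, f (X p) * X p ∂P
        = ∫ p, (Y p - X p) * (f (Y p) - f (X p)) / (2 * a) ∂P := by
      rw [integral_div, h2]
      field_simp
    have h4 : ∫ p, ramp L s (X p) ∂P - N = ∫ p, f' (X p) ∂P - ∫ p, f (X p) * X p ∂P := by
      rw [← integral_sub (Continuous.integrable_of_compactSpace (by fun_prop))
        (Continuous.integrable_of_compactSpace (by fun_prop))]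
      have h5 : ∀ p, f' (X p) - f (X p) * X p = ramp L s (X p) - N := fun p => by
        simp only [hf'_def, hk_def]
        ring
      simp only [h5]
      have hr := continuous_ramp L s
      rw [integral_sub (Continuous.integrable_of_compactSpace (by fun_prop))
        (integrable_const _)]
      simp
    rw [h4, h3, ← integral_sub (Continuous.integrable_of_compactSpace (by fun_prop))
        (Continuous.integrable_of_compactSpace (by fun_prop)),
      ← integral_sub (Continuous.integrable_of_compactSpace (by fun_prop))
        (Continuous.integrable_of_compactSpace (by fun_prop))]
    congr 1
    ext p
    field_simp
    ring
  have h6 : |∫ p, (Y p - X p) * (f (Y p) - f (X p) - (Y p - X p) * f' (X p)) / (2 * a) ∂P|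
      ≤ L * (∫ p, |Y p - X p| ^ 3 ∂P) / (4 * a) := by
    rw [mul_div_right_comm, ← integral_const_mul, ← Real.norm_eq_abs]
    refine norm_integral_le_of_norm_le (Continuous.integrable_of_compactSpace (by fun_prop))
      (ae_of_all _ fun p => ?_)
    rw [Real.norm_eq_abs, abs_div, abs_mul, abs_of_pos (show 0 < 2 * a by linarith)]
    rw [div_le_iff₀ (by linarith)]
    calc |Y p - X p| * |f (Y p) - f (X p) - (Y p - X p) * f' (X p)|
        ≤ |Y p - X p| * (L * (Y p - X p) ^ 2 / 2) := by
          gcongr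
          exact htaylor _ _
      _ = L / (4 * a) * |Y p - X p| ^ 3 * (2 * a) := by
        rw [← sq_abs (Y p - X p)]
        field_simp
        ring
  rw [h1]
  exact (abs_sub _ _).trans (add_le_add (hA f' hf'c hf'2) h6)

/-- The indicator of (-∞, x] lies between the ramps starting at x - 1/L and at x. Moving the
Gaussian distribution function by 1/L costs the last term. -/
theorem IsSteinPair.abs_measureReal_sub_gaussCDF_le (h : IsSteinPair P X Y a) (ha : 0 < a)
    (hA : ∀ φ : ℝ → ℝ, Continuous φ → (∀ x, |φ x| ≤ 2) →
      |∫ p, φ (X p) * (1 - (Y p - X p) ^ 2 / (2 * a)) ∂P| ≤ 2 * A) {L : ℝ} (hL : 0 < L) (x : ℝ) :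
    |P.real {p | X p ≤ x} - gaussCDF x|
      ≤ 2 * A + L * (∫ p, |Y p - X p| ^ 3 ∂P) / (4 * a) + 1 / L / √(2 * Real.pi) := by
  have hX := h.continuous_fst
  have hms : ∀ s, MeasurableSet {p | X p ≤ s} := fun s =>
    (isClosed_le hX continuous_const).measurableSet
  have hr := continuous_ramp L
  have hP : ∀ s, ∫ p, (Iic s).indicator (fun _ => (1 : ℝ)) (X p) ∂P = P.real {p | X p ≤ s} :=
    fun s => by
      rw [← integral_indicator_one (hms s)]
      rfl
  have hPi : ∀ s, Integrable (fun p => (Iic s).indicator (fun _ => (1 : ℝ)) (X p)) P :=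
    fun s => (integrable_const (1 : ℝ)).indicator (hms s)
  have hlow : ∀ s, P.real {p | X p ≤ s} ≤ ∫ p, ramp L s (X p) ∂P := fun s => by
    rw [← hP]
    exact integral_mono (hPi s) (Continuous.integrable_of_compactSpace ((hr s).comp hX))
      fun p => indicator_Iic_le_ramp hL.le s _
  have hupp : ∀ s, ∫ p, ramp L s (X p) ∂P ≤ P.real {p | X p ≤ s + 1 / L} := fun s => by
    rw [← hP]
    exact integral_mono (Continuous.integrable_of_compactSpace ((hr s).comp hX)) (hPi _)
      fun p => ramp_le_indicator_Iic hL s _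
  have hs := fun s => abs_le.1 (h.abs_integral_ramp_sub_le ha hA hL.le s)
  have hδ : 0 ≤ 1 / L := by positivity
  rw [abs_le]
  constructor
  · have h1 := hupp (x - 1 / L)
    have h2 := (hs (x - 1 / L)).1
    have h3 := gaussCDF_le_gaussMean_ramp hL.le (x - 1 / L)
    have h4 := gaussCDF_add_le (x - 1 / L) hδ
    rw [sub_add_cancel] at h1 h4
    linarith
  · have h1 := hlow x
    have h2 := (hs x).2
    have h3 := gaussMean_ramp_le_gaussCDF hL x
    have h4 := gaussCDF_add_le x hδ
    linarith

/-- Stein's bound on the Kolmogorov distance to the standard Gaussian, with the third moment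
of `Y - X` estimated by the second and the fourth. -/
theorem IsSteinPair.abs_measureReal_sub_gaussCDF_le_fourth (h : IsSteinPair P X Y a) (ha : 0 < a)
    (hA : ∀ φ : ℝ → ℝ, Continuous φ → (∀ x, |φ x| ≤ 2) →
      |∫ p, φ (X p) * (1 - (Y p - X p) ^ 2 / (2 * a)) ∂P| ≤ 2 * A) (x : ℝ) :
    |P.real {p | X p ≤ x} - gaussCDF x|
      ≤ 2 * A + (1 / Real.pi * ((∫ p, (Y p - X p) ^ 4 ∂P) / a)) ^ (1 / 4 : ℝ) := by
  have hX := h.continuous_fst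
  have hY := h.continuous_snd
  have hI : ∀ n : ℕ, Integrable (fun p => (Y p - X p) ^ n) P := fun n =>
    Continuous.integrable_of_compactSpace (by fun_prop)
  set M := ∫ p, (Y p - X p) ^ 4 ∂P with hM
  have hπ := Real.pi_pos
  -- The variance of (Y - X)² is nonnegative, so M ≥ 4a². Positivity of M makes q positive, hence a
  -- legitimate denominator.
  have hMpos : 0 < M := by
    have h1 : 0 ≤ ∫ p, ((Y p - X p) ^ 2 - 2 * a) ^ 2 ∂P := integral_nonneg fun p => sq_nonneg _
    have h2 : ∫ p, ((Y p - X p) ^ 2 - 2 * a) ^ 2 ∂P = M - 4 * a * (2 * a) + (2 * a) ^ 2 := by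
      have h3 : ∀ p, ((Y p - X p) ^ 2 - 2 * a) ^ 2
          = ((Y p - X p) ^ 4 - 4 * a * (Y p - X p) ^ 2) + (2 * a) ^ 2 := fun p => by ring
      simp only [h3]
      rw [integral_add (Continuous.integrable_of_compactSpace (by fun_prop)) (integrable_const _),
        integral_sub (hI 4) ((hI 2).const_mul _), integral_const_mul, h.integral_sq]
      simp [hM]
    have : 0 < a * a := mul_pos ha ha
    nlinarith
  set q := (1 / Real.pi * (M / a)) ^ (1 / 4 : ℝ) with hq
  have hbase : 0 < 1 / Real.pi * (M / a) := by positivity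
  have hqpos : 0 < q := Real.rpow_pos_of_pos hbase _
  have hq4 : q ^ 4 = 1 / Real.pi * (M / a) := by
    rw [hq, ← Real.rpow_natCast, ← Real.rpow_mul hbase.le]
    norm_num
  set c := √(2 * Real.pi) with hc
  have hcpos : 0 < c := Real.sqrt_pos.2 (by positivity)
  have hc2 : c ^ 2 = 2 * Real.pi := Real.sq_sqrt (by positivity)
  have hMq : M = a * q ^ 4 * c ^ 2 / 2 := by
    rw [hq4, hc2]
    field_simp
  -- This is Cauchy–Schwarz, E|D|³ ≤ √(E D² · E D⁴), done as a pointwise AM-GM inequality whose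
  -- weights make both terms integrate to a·q²·c/2.
  have hT : ∫ p, |Y p - X p| ^ 3 ∂P ≤ a * q ^ 2 * c := by
    have h1 : ∀ p, |Y p - X p| ^ 3
        ≤ q ^ 2 * c / 4 * (Y p - X p) ^ 2 + 1 / (q ^ 2 * c) * (Y p - X p) ^ 4 := fun p => by
      set t := |Y p - X p| with ht
      have h2 : (Y p - X p) ^ 2 = t ^ 2 := (sq_abs _).symm
      have h4 : (Y p - X p) ^ 4 = t ^ 4 := by
        rw [show (Y p - X p) ^ 4 = ((Y p - X p) ^ 2) ^ 2 by ring, h2]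
        ring
      rw [h2, h4]
      have h5 : q ^ 2 * c / 4 * t ^ 2 + 1 / (q ^ 2 * c) * t ^ 4 - t ^ 3
          = (q ^ 2 * c) * (t / 2 - t ^ 2 / (q ^ 2 * c)) ^ 2 := by
        field_simp
        ring
      have h6 : 0 ≤ (q ^ 2 * c) * (t / 2 - t ^ 2 / (q ^ 2 * c)) ^ 2 := by positivity
      linarith
    calc ∫ p, |Y p - X p| ^ 3 ∂P
        ≤ ∫ p, (q ^ 2 * c / 4 * (Y p - X p) ^ 2 + 1 / (q ^ 2 * c) * (Y p - X p) ^ 4) ∂P :=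
          integral_mono (Continuous.integrable_of_compactSpace (by fun_prop))
            (((hI 2).const_mul _).add ((hI 4).const_mul _)) h1
      _ = q ^ 2 * c / 4 * (2 * a) + 1 / (q ^ 2 * c) * M := by
          rw [integral_add ((hI 2).const_mul _) ((hI 4).const_mul _), integral_const_mul,
            integral_const_mul, h.integral_sq]
      _ = a * q ^ 2 * c := by
          rw [hMq]
          field_simp
          ring
  -- This slope minimizes L·q²·c/4 + 1/(L·c): both summands equal q/2.
  have hL : 0 < 2 / (q * c) := by positivity
  refine (h.abs_measureReal_sub_gaussCDF_le ha hA hL x).trans ?_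
  have h1 : 2 / (q * c) * (∫ p, |Y p - X p| ^ 3 ∂P) / (4 * a)
      ≤ 2 / (q * c) * (a * q ^ 2 * c) / (4 * a) := by gcongr
  have h2 : 2 / (q * c) * (a * q ^ 2 * c) / (4 * a) + 1 / (2 / (q * c)) / c = q := by
    field_simp
    ring
  linarith

end ExchangeablePair

end SteinMethod

noncomputable section

open MeasureTheory

/-! ### Linear algebra -/

section LinearAlgebra

open Module.Basis in
-- In a basis of W extended by lifts of a basis of V ⧸ W, the matrix of e is block triangular.
theorem LinearMap.trace_eq_trace_restrict_add_trace_mapQ {K V : Type*} [Field K] [AddCommGroup V]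
    [Module K V] [FiniteDimensional K V] (W : Submodule K V) (e : V →ₗ[K] V)
    (he : W ≤ W.comap e) :
    LinearMap.trace K V e
      = LinearMap.trace K W (e.restrict he) + LinearMap.trace K (V ⧸ W) (W.mapQ W e he) := by
  let bW := Module.Free.chooseBasis K W
  let bQ := Module.Free.chooseBasis K (V ⧸ W)
  let b := sumQuot bW bQ
  rw [LinearMap.trace_eq_matrix_trace K b, LinearMap.trace_eq_matrix_trace K bW,
    LinearMap.trace_eq_matrix_trace K bQ, Matrix.trace, Fintype.sum_sum_type]
  congr 1
  · refine Finset.sum_congr rfl fun i _ => ?_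
    simp only [Matrix.diag_apply, b, LinearMap.toMatrix_apply, sumQuot_inl]
    apply sumQuot_repr_inl_of_mem
  · refine Finset.sum_congr rfl fun i _ => ?_
    simp only [Matrix.diag_apply, b, LinearMap.toMatrix_apply, sumQuot_repr_inr]
    rw [← sumQuot_inr bW bQ i, W.mapQ_apply]
    simp

end LinearAlgebra

/-! ### Weak integrals of families of endomorphisms -/

section WeakIntegral

variable {X : Type*} [TopologicalSpace X] [CompactSpace X] [MeasurableSpace X] [BorelSpace X]
  {W : Type*} [AddCommGroup W] [Module ℂ W] [FiniteDimensional ℂ W]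

/-- W carries no topology, so the integral is defined by pairing with functionals and identifying W
with its double dual. -/
theorem exists_weak_integral (μ : Measure X) [IsFiniteMeasure μ] {T : X → Module.End ℂ W}
    (hT : ∀ (f : Module.Dual ℂ W) (v : W), Continuous fun x => f (T x v)) :
    ∃ P : Module.End ℂ W, (∀ (f : Module.Dual ℂ W) (v : W), f (P v) = ∫ x, f (T x v) ∂μ) ∧
      ∀ S : Module.End ℂ W, LinearMap.trace ℂ W (S * P) = ∫ x, LinearMap.trace ℂ W (S * T x) ∂μ := by
  have hi : ∀ (f : Module.Dual ℂ W) (v : W), Integrable (fun x => f (T x v)) μ := fun f v =>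
    (hT f v).integrable_of_compactSpace
  let B : W →ₗ[ℂ] Module.Dual ℂ (Module.Dual ℂ W) :=
    { toFun := fun v =>
        { toFun := fun f => ∫ x, f (T x v) ∂μ
          map_add' := fun f f' => by
            simp only [LinearMap.add_apply]
            exact integral_add (hi f v) (hi f' v)
          map_smul' := fun c f => by
            simp only [LinearMap.smul_apply, smul_eq_mul, RingHom.id_apply]
            exact integral_const_mul c _ }
      map_add' := fun v v' => by
        ext f
        simp only [map_add, LinearMap.coe_mk, AddHom.coe_mk, LinearMap.add_apply]
        exact integral_add (hi f v) (hi f v')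
      map_smul' := fun c v => by
        ext f
        simp only [map_smul, LinearMap.coe_mk, AddHom.coe_mk, LinearMap.smul_apply, smul_eq_mul,
          RingHom.id_apply]
        exact integral_const_mul c _ }
  let P : Module.End ℂ W := (Module.evalEquiv ℂ W).symm.toLinearMap ∘ₗ B
  have hP : ∀ (f : Module.Dual ℂ W) (v : W), f (P v) = ∫ x, f (T x v) ∂μ := fun f v => by
    have h : Module.evalEquiv ℂ W (P v) = B v := (Module.evalEquiv ℂ W).apply_symm_apply _
    exact LinearMap.congr_fun h f
  refine ⟨P, hP, fun S => ?_⟩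
  let b := Module.finBasis ℂ W
  have htr : ∀ Q : Module.End ℂ W, LinearMap.trace ℂ W (S * Q)
      = ∑ i, (b.coord i ∘ₗ S) (Q (b i)) := fun Q => by
    rw [LinearMap.trace_eq_matrix_trace ℂ b, Matrix.trace]
    simp [LinearMap.toMatrix_apply]
  simp only [htr]
  rw [integral_finsetSum _ fun i _ => hi _ _]
  exact Finset.sum_congr rfl fun i _ => hP _ _

end WeakIntegral

/-! ### Representations with continuous matrix coefficients -/

namespace Representation

section ContinuousCoeff

variable {G V W : Type*} [Group G] [TopologicalSpace G] [AddCommGroup V] [Module ℂ V]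
  [AddCommGroup W] [Module ℂ W]

/-- All matrix coefficients of the representation `ρ` are continuous. -/
def ContinuousCoeff (ρ : Representation ℂ G W) : Prop :=
  ∀ (f : Module.Dual ℂ W) (v : W), Continuous fun g => f (ρ g v)

variable {ρ : Representation ℂ G V} {σ : Representation ℂ G W}

/-- Coefficients need no topology on the space, so the condition passes to duals, tensor products,
subspaces, quotients and conjugates. -/
theorem IsContinuousAction.continuousCoeff [FiniteDimensional ℂ V] [TopologicalSpace V]
    [IsTopologicalAddGroup V] [ContinuousSMul ℂ V] [T2Space V] (h : ρ.IsContinuousAction) :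
    ρ.ContinuousCoeff := fun f v => by
  have hf : Continuous f := f.continuous_of_finiteDimensional
  have h' : Continuous fun p : G × V => ρ p.1 p.2 := h
  exact hf.comp (h'.comp (continuous_id.prodMk continuous_const))

theorem ContinuousCoeff.isContinuousAction_pi {n : ℕ} {ρ : Representation ℂ G (Fin n → ℂ)}
    (h : ρ.ContinuousCoeff) : ρ.IsContinuousAction := by
  refine continuous_pi fun i => ?_
  have h1 : ∀ p : G × (Fin n → ℂ), ρ p.1 p.2 i
      = ∑ j, p.2 j * LinearMap.proj (R := ℂ) (φ := fun _ : Fin n => ℂ) i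
        (ρ p.1 (Pi.single j 1)) := fun p => by
    conv_lhs => rw [← (Pi.basisFun ℂ (Fin n)).sum_repr p.2]
    simp
  simp only [h1]
  refine continuous_finsetSum _ fun j _ => ?_
  refine Continuous.mul (by fun_prop) ?_
  exact (h (LinearMap.proj i) (Pi.single j 1)).comp continuous_fst

theorem ContinuousCoeff.of_equiv (e : ρ.Equiv σ) (h : ρ.ContinuousCoeff) :
    σ.ContinuousCoeff := fun f v => by
  have h1 := h (f ∘ₗ e.toLinearMap) (e.symm v)
  refine h1.congr fun g => ?_
  have h2 := LinearMap.congr_fun (e.toIntertwiningMap.isIntertwining' g) (e.symm v)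
  simp only [LinearMap.comp_apply] at h2 ⊢
  rw [h2]
  congr 2
  exact e.toLinearEquiv.apply_symm_apply v

theorem ContinuousCoeff.prod (hρ : ρ.ContinuousCoeff) (hσ : σ.ContinuousCoeff) :
    (ρ.prod σ).ContinuousCoeff := fun f v => by
  have h := (hρ (f ∘ₗ LinearMap.inl ℂ V W) v.1).add (hσ (f ∘ₗ LinearMap.inr ℂ V W) v.2)
  refine h.congr fun g => ?_
  have h1 : (ρ.prod σ) g v = LinearMap.inl ℂ V W (ρ g v.1) + LinearMap.inr ℂ V W (σ g v.2) := by
    ext <;> simp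
  rw [h1, map_add]
  rfl

theorem ContinuousCoeff.of_basis {ι : Type*} [Fintype ι] (b : Module.Basis ι ℂ V)
    (h : ∀ i j, Continuous fun g => b.repr (ρ g (b j)) i) : ρ.ContinuousCoeff := fun f v => by
  have h1 : ∀ g, f (ρ g v) = ∑ j, b.repr v j * ∑ i, b.repr (ρ g (b j)) i * f (b i) := fun g => by
    conv_lhs => rw [← b.sum_repr v]
    simp only [map_sum, map_smul, smul_eq_mul]
    refine Finset.sum_congr rfl fun j _ => ?_
    conv_lhs => rw [← b.sum_repr (ρ g (b j))]
    simp only [map_sum, map_smul, smul_eq_mul]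
  simp only [h1]
  fun_prop

theorem ContinuousCoeff.tprod [FiniteDimensional ℂ V] [FiniteDimensional ℂ W]
    (hρ : ρ.ContinuousCoeff) (hσ : σ.ContinuousCoeff) : (ρ.tprod σ).ContinuousCoeff := by
  let b := Module.finBasis ℂ V
  let c := Module.finBasis ℂ W
  refine ContinuousCoeff.of_basis (b.tensorProduct c) fun i j => ?_
  refine ((hρ (b.coord i.1) (b j.1)).mul (hσ (c.coord i.2) (c j.2))).congr fun g => ?_
  rw [Module.Basis.tensorProduct_apply', tprod_apply, TensorProduct.map_tmul,
    Module.Basis.tensorProduct_repr_tmul_apply, smul_eq_mul, mul_comm]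
  rfl

theorem ContinuousCoeff.dual [IsTopologicalGroup G] [FiniteDimensional ℂ V]
    (hρ : ρ.ContinuousCoeff) : ρ.dual.ContinuousCoeff := fun f φ => by
  obtain ⟨v, rfl⟩ := (Module.evalEquiv ℂ V).surjective f
  exact (hρ φ v).comp continuous_inv

theorem ContinuousCoeff.linHom [IsTopologicalGroup G] [FiniteDimensional ℂ V]
    [FiniteDimensional ℂ W] (hρ : ρ.ContinuousCoeff) (hσ : σ.ContinuousCoeff) :
    (ρ.linHom σ).ContinuousCoeff :=
  (hρ.dual.tprod hσ).of_equiv (Equiv.dualTensorHom ρ σ)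

theorem ContinuousCoeff.subrepresentation (hρ : ρ.ContinuousCoeff) (U : Submodule ℂ V)
    (hU : ∀ g, U ≤ U.comap (ρ g)) : (ρ.subrepresentation U hU).ContinuousCoeff := fun f v => by
  obtain ⟨f', rfl⟩ := LinearMap.exists_extend f
  exact hρ f' v

theorem ContinuousCoeff.quotient (hρ : ρ.ContinuousCoeff) (U : Submodule ℂ V)
    (hU : ∀ g, U ≤ U.comap (ρ g)) : (ρ.quotient U hU).ContinuousCoeff := fun f v => by
  obtain ⟨v, rfl⟩ := U.mkQ_surjective v
  exact hρ (f ∘ₗ U.mkQ) v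

theorem ContinuousCoeff.conjRep (hρ : ρ.ContinuousCoeff) : ρ.conjRep.ContinuousCoeff :=
  fun f v => by
    let f' : Module.Dual ℂ V :=
      { toFun := fun w => conj (f (show ConjSpace V from w))
        map_add' := fun w w' => by
          rw [← map_add]
          exact congrArg conj (f.map_add _ _)
        map_smul' := fun c w => by
          have h : f (show ConjSpace V from c • w) = conj c * f (show ConjSpace V from w) := by
            rw [← smul_eq_mul, ← f.map_smul]
            congr 1
            show c • w = conj (conj c) • w
            rw [Complex.conj_conj]
          rw [h]
          simp }
    refine (Complex.continuous_conj.comp (hρ f' v)).congr fun g => ?_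
    exact Complex.conj_conj _

theorem ContinuousCoeff.continuous_character [FiniteDimensional ℂ V] (hρ : ρ.ContinuousCoeff) :
    Continuous ρ.character := by
  let b := Module.finBasis ℂ V
  have h : ρ.character = fun g => ∑ i, b.coord i (ρ g (b i)) := by
    ext g
    rw [character, LinearMap.trace_eq_matrix_trace ℂ b, Matrix.trace]
    simp [LinearMap.toMatrix_apply]
  rw [h]
  exact continuous_finsetSum _ fun i _ => hρ _ _

/-- The coordinates on the conjugate space given by a basis of the original space. -/
def conjEquivFun {ι : Type*} [Finite ι] (b : Module.Basis ι ℂ V) :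
    ConjSpace V ≃ₗ[ℂ] (ι → ℂ) where
  toFun v i := conj (b.equivFun (show V from v) i)
  map_add' v w := by
    funext i
    have h := congrFun (b.equivFun.map_add (show V from v) (show V from w)) i
    exact (congrArg conj h).trans (map_add _ _ _)
  map_smul' c v := by
    funext i
    have h := congrFun (b.equivFun.map_smul (conj c) (show V from v)) i
    refine (congrArg conj h).trans ?_
    simp
  invFun x := b.equivFun.symm fun i => conj (x i)
  left_inv v := by
    simp only [Complex.conj_conj]
    exact b.equivFun.symm_apply_apply _
  right_inv x := by
    funext i
    refine (congrArg conj (congrFun (b.equivFun.apply_symm_apply fun i => conj (x i)) i)).trans ?_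
    exact Complex.conj_conj _

instance [FiniteDimensional ℂ V] : FiniteDimensional ℂ (ConjSpace V) :=
  Module.Finite.equiv (conjEquivFun (Module.finBasis ℂ V)).symm

omit [TopologicalSpace G] in
theorem conjRep_character [FiniteDimensional ℂ V] (ρ : Representation ℂ G V) (g : G) :
    ρ.conjRep.character g = conj (ρ.character g) := by
  let b := Module.finBasis ℂ V
  let b' := Module.Basis.ofEquivFun (conjEquivFun b)
  rw [character, character, LinearMap.trace_eq_matrix_trace ℂ b,
    LinearMap.trace_eq_matrix_trace ℂ b', Matrix.trace, Matrix.trace, map_sum]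
  refine Finset.sum_congr rfl fun i _ => ?_
  rw [Matrix.diag_apply, Matrix.diag_apply, LinearMap.toMatrix_apply, LinearMap.toMatrix_apply]
  have h1 : b' i = (show ConjSpace V from b i) := by
    rw [Module.Basis.coe_ofEquivFun]
    show b.equivFun.symm (fun j => conj ((Pi.single i 1 : Fin _ → ℂ) j)) = b i
    simp [Module.Basis.equivFun_symm_apply, Pi.single_apply, apply_ite (starRingEnd ℂ), ite_smul]
  rw [h1]
  rfl

end ContinuousCoeff

/-! ### Irreducibility in terms of invariant submodules. -/

section Irreducible

variable {k G V W : Type*} [Field k] [Monoid G] [AddCommGroup V] [Module k V]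
  [AddCommGroup W] [Module k W] {ρ : Representation k G V} {σ : Representation k G W}

theorem isIrreducible_iff_forall_submodule :
    ρ.IsIrreducible ↔ Nontrivial V ∧
      ∀ U : Submodule k V, (∀ g, U ≤ U.comap (ρ g)) → U = ⊥ ∨ U = ⊤ := by
  have hbot : (⊥ : Subrepresentation ρ).toSubmodule = ⊥ := rfl
  have htop : (⊤ : Subrepresentation ρ).toSubmodule = ⊤ := rfl
  constructor
  · intro h
    refine ⟨?_, fun U hU => ?_⟩
    · by_contra hV
      rw [not_nontrivial_iff_subsingleton] at hV
      obtain ⟨U, U', hne⟩ := h.toNontrivial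
      exact hne (Subrepresentation.toSubmodule_injective (Subsingleton.elim _ _))
    · rcases h.eq_bot_or_eq_top ⟨U, fun g v hv => hU g hv⟩ with h | h
      · exact Or.inl (congrArg Subrepresentation.toSubmodule h)
      · exact Or.inr (congrArg Subrepresentation.toSubmodule h)
  · rintro ⟨hV, h⟩
    refine { exists_pair_ne := ⟨⊥, ⊤, fun hne => ?_⟩, eq_bot_or_eq_top := fun U => ?_ }
    · exact bot_ne_top (congrArg Subrepresentation.toSubmodule hne)
    · rcases h U.toSubmodule fun g v hv => U.apply_mem_toSubmodule g hv with h | h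
      · exact Or.inl (Subrepresentation.toSubmodule_injective h)
      · exact Or.inr (Subrepresentation.toSubmodule_injective h)

theorem IsIrreducible.of_equiv (e : ρ.Equiv σ) (h : ρ.IsIrreducible) : σ.IsIrreducible := by
  rw [isIrreducible_iff_forall_submodule] at h ⊢
  have h0 := h.1
  refine ⟨e.toLinearEquiv.symm.toEquiv.nontrivial, fun U hU => ?_⟩
  have h1 : ∀ g v, e.toLinearEquiv (ρ g v) = σ g (e.toLinearEquiv v) := fun g v =>
    LinearMap.congr_fun (e.toIntertwiningMap.isIntertwining' g) v
  have h2 := h.2 (U.comap e.toLinearEquiv.toLinearMap) fun g v hv => by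
    show e.toLinearEquiv (ρ g v) ∈ U
    rw [h1]
    exact hU g hv
  have h3 : U = (U.comap e.toLinearEquiv.toLinearMap).map e.toLinearEquiv.toLinearMap :=
    (Submodule.map_comap_eq_of_surjective e.toLinearEquiv.surjective U).symm
  rcases h2 with h2 | h2
  · left
    rw [h3, h2, Submodule.map_bot]
  · right
    rw [h3, h2, Submodule.map_top, LinearEquiv.range]

end Irreducible

/-! ### Haar averaging: orthogonality relations, unitarity and Schur averages. -/

section Haar

variable {G V W : Type*} [Group G] [TopologicalSpace G] [IsTopologicalGroup G] [CompactSpace G]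
  [MeasurableSpace G] [BorelSpace G] (μ : Measure G) [μ.IsHaarMeasure] [IsProbabilityMeasure μ]
  [AddCommGroup V] [Module ℂ V] [FiniteDimensional ℂ V]
  [AddCommGroup W] [Module ℂ W] [FiniteDimensional ℂ W]
  {ρ : Representation ℂ G V} {σ : Representation ℂ G W}

/-- The Haar average of ρ is a projection onto the invariants, and the trace of a projection is its
rank. -/
theorem integral_character_eq_finrank_invariants (hρ : ρ.ContinuousCoeff) :
    ∫ g, ρ.character g ∂μ = Module.finrank ℂ ρ.invariants := by
  obtain ⟨P, hP, htr⟩ := exists_weak_integral μ (T := fun g => ρ g) hρ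
  have hproj : LinearMap.IsProj ρ.invariants P := by
    refine ⟨fun v h => ?_, fun v hv => ?_⟩
    · rw [← sub_eq_zero, ← Module.forall_dual_apply_eq_zero_iff ℂ]
      intro f
      have h1 := hP (f ∘ₗ ρ h) v
      simp only [LinearMap.comp_apply] at h1
      rw [map_sub, h1, hP]
      have h2 : ∀ g, f (ρ h (ρ g v)) = f (ρ (h * g) v) := fun g => by
        rw [map_mul]
        rfl
      simp only [h2]
      rw [integral_mul_left_eq_self (fun g => f (ρ g v)) h, sub_self]
    · rw [← sub_eq_zero, ← Module.forall_dual_apply_eq_zero_iff ℂ]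
      intro f
      rw [map_sub, hP]
      simp only [(mem_invariants ρ v).1 hv]
      simp
  have h1 := htr 1
  simp only [one_mul] at h1
  rw [← hproj.trace, h1]
  rfl

theorem integral_character_inv_mul_character (hρ : ρ.ContinuousCoeff) (hσ : σ.ContinuousCoeff) :
    ∫ g, ρ.character g⁻¹ * σ.character g ∂μ = Module.finrank ℂ (IntertwiningMap ρ σ) := by
  simp only [← char_linHom]
  rw [integral_character_eq_finrank_invariants μ (hρ.linHom hσ),
    (invariantsEquivIntertwiningMap ρ σ).finrank_eq]

include μ in
-- Weyl's unitary trick in matrices. The average H of M(g)M(g)* satisfies M(h)HM(h)* = H and is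
-- invertible, so M(h⁻¹) = H M(h)* H⁻¹; take traces.
theorem character_inv (hρ : ρ.ContinuousCoeff) (h : G) :
    ρ.character h⁻¹ = conj (ρ.character h) := by
  let b := Module.finBasis ℂ V
  let M : G → Matrix _ _ ℂ := fun g => LinearMap.toMatrix b b (ρ g)
  have hMc : ∀ i j, Continuous fun g => M g i j := fun i j => by
    simp only [M, LinearMap.toMatrix_apply]
    exact hρ (b.coord i) (b j)
  have hMmul : ∀ g g', M (g * g') = M g * M g' := fun g g' => by
    simp only [M, map_mul, LinearMap.toMatrix_mul]
  have hM1 : M 1 = 1 := by simp only [M, map_one, LinearMap.toMatrix_one]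
  have hNc : ∀ i j, Continuous fun g => (M g * (M g).conjTranspose) i j := fun i j => by
    simp only [Matrix.mul_apply, Matrix.conjTranspose_apply]
    exact continuous_finsetSum _ fun l _ => (hMc i l).mul ((hMc j l).star)
  have hNi : ∀ i j, Integrable (fun g => (M g * (M g).conjTranspose) i j) μ := fun i j =>
    (hNc i j).integrable_of_compactSpace
  let H : Matrix (Fin (Module.finrank ℂ V)) (Fin (Module.finrank ℂ V)) ℂ :=
    Matrix.of fun i j => ∫ g, (M g * (M g).conjTranspose) i j ∂μ
  have hinv : M h * H * (M h).conjTranspose = H := by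
    ext i j
    have h1 : (M h * H * (M h).conjTranspose) i j
        = ∫ g, (M (h * g) * (M (h * g)).conjTranspose) i j ∂μ := by
      have h2 : ∀ g, (M (h * g) * (M (h * g)).conjTranspose) i j
          = ∑ l, (∑ m, M h i m * (M g * (M g).conjTranspose) m l) * (M h).conjTranspose l j :=
        fun g => by
          rw [hMmul, Matrix.conjTranspose_mul, Matrix.mul_assoc, ← Matrix.mul_assoc (M g),
            ← Matrix.mul_assoc, Matrix.mul_apply]
          exact Finset.sum_congr rfl fun l _ => by rw [Matrix.mul_apply]
      simp only [h2]
      rw [integral_finsetSum _ fun l _ => (integrable_finsetSum _ fun m _ =>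
        (hNi m l).const_mul _).mul_const _]
      rw [Matrix.mul_apply]
      refine Finset.sum_congr rfl fun l _ => ?_
      rw [integral_mul_const, integral_finsetSum _ fun m _ => (hNi m l).const_mul _,
        Matrix.mul_apply]
      simp only [integral_const_mul]
      rfl
    rw [h1, integral_mul_left_eq_self (fun g => (M g * (M g).conjTranspose) i j) h]
    rfl
  -- For x in the kernel, x*Hx = ∫ |M(g)*x|² = 0. The integrand is continuous and Haar measure
  -- charges open sets, so it vanishes at g = 1, where it equals |x|².
  have hinj : ∀ x, H.mulVec x = 0 → x = 0 := fun x hx => by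
    let F : G → ℝ := fun g => ∑ i, Complex.normSq (((M g).conjTranspose.mulVec x) i)
    have hFc : Continuous F := by
      refine continuous_finsetSum _ fun i _ => Complex.continuous_normSq.comp ?_
      simp only [Matrix.mulVec, dotProduct, Matrix.conjTranspose_apply]
      exact continuous_finsetSum _ fun l _ => ((hMc l i).star).mul continuous_const
    have hF : ∀ g, (F g : ℂ)
        = ∑ i, ∑ j, star (x i) * (M g * (M g).conjTranspose) i j * x j := fun g => by
      have h1 : (F g : ℂ) = star ((M g).conjTranspose.mulVec x) ⬝ᵥ
          ((M g).conjTranspose.mulVec x) := by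
        simp only [F, dotProduct, Complex.ofReal_sum, Pi.star_apply]
        exact Finset.sum_congr rfl fun i _ => Complex.normSq_eq_conj_mul_self
      rw [h1, Matrix.star_mulVec, Matrix.conjTranspose_conjTranspose,
        ← Matrix.dotProduct_mulVec, Matrix.mulVec_mulVec]
      simp only [dotProduct, Matrix.mulVec, Pi.star_apply, Finset.mul_sum, mul_assoc]
    have hF0 : ∫ g, F g ∂μ = 0 := by
      have h2 : ((∫ g, F g ∂μ : ℝ) : ℂ) = 0 := by
        rw [← integral_complex_ofReal]
        simp only [hF]
        rw [integral_finsetSum _ fun i _ => integrable_finsetSum _ fun j _ =>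
          ((hNi i j).const_mul _).mul_const _]
        have h3 : ∀ i, ∫ g, ∑ j, star (x i) * (M g * (M g).conjTranspose) i j * x j ∂μ
            = star (x i) * H.mulVec x i := fun i => by
          rw [integral_finsetSum _ fun j _ => ((hNi i j).const_mul _).mul_const _]
          simp only [integral_mul_const, integral_const_mul]
          rw [Matrix.mulVec, dotProduct, Finset.mul_sum]
          exact Finset.sum_congr rfl fun j _ => mul_assoc _ _ _
        simp only [h3, hx]
        simp
      exact_mod_cast h2
    have hFnn : ∀ g, 0 ≤ F g := fun g => Finset.sum_nonneg fun i _ => Complex.normSq_nonneg _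
    have hFz : F = 0 := by
      have h4 := (integral_eq_zero_iff_of_nonneg hFnn
        (hFc.integrable_of_compactSpace (P := μ))).1 hF0
      exact (hFc.ae_eq_iff_eq μ continuous_const).1 h4
    have h5 : F 1 = 0 := congrFun hFz 1
    funext i
    have h6 := (Finset.sum_eq_zero_iff_of_nonneg fun i _ => Complex.normSq_nonneg _).1 h5 i
      (Finset.mem_univ i)
    rw [Complex.normSq_eq_zero, hM1, Matrix.conjTranspose_one, Matrix.one_mulVec] at h6
    exact h6
  have hunit : IsUnit H := by
    rw [← Matrix.mulVec_injective_iff_isUnit]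
    intro x y hxy
    rw [← sub_eq_zero]
    refine hinj _ ?_
    rw [Matrix.mulVec_sub]
    exact sub_eq_zero.2 hxy
  obtain ⟨u, hu⟩ := hunit
  have h7 : M h⁻¹ * M h = 1 := by rw [← hMmul, inv_mul_cancel, hM1]
  have h8 : H * (M h).conjTranspose = M h⁻¹ * H := by
    rw [← Matrix.one_mul (H * _), ← h7, Matrix.mul_assoc, ← Matrix.mul_assoc (M h), hinv]
  have h9 : M h⁻¹ = H * (M h).conjTranspose * ((u⁻¹ : (Matrix _ _ ℂ)ˣ) : Matrix _ _ ℂ) := by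
    rw [h8, ← hu, Matrix.mul_assoc, Units.mul_inv, Matrix.mul_one]
  have htr : ∀ g, ρ.character g = (M g).trace := fun g =>
    LinearMap.trace_eq_matrix_trace ℂ b _
  rw [htr, htr, h9, Matrix.trace_mul_comm, ← Matrix.mul_assoc, ← hu, Units.inv_mul,
    Matrix.one_mul, Matrix.trace_conjTranspose]
  rfl

theorem integral_character_mul_conj (hρ : ρ.ContinuousCoeff) (hσ : σ.ContinuousCoeff) :
    ∫ g, conj (ρ.character g) * σ.character g ∂μ = Module.finrank ℂ (IntertwiningMap ρ σ) := by
  simp only [← character_inv μ hρ]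
  exact integral_character_inv_mul_character μ hρ hσ

theorem integral_character_mul_conj_self (hρ : ρ.ContinuousCoeff) (hirr : ρ.IsIrreducible) :
    ∫ g, conj (ρ.character g) * ρ.character g ∂μ = 1 := by
  rw [integral_character_mul_conj μ hρ hρ, IsIrreducible.finrank_intertwiningMap_self]
  simp

/-- The integral is dim Hom_G(ρ̄, ρ). A nonzero intertwiner is onto as ρ is irreducible, and
bijective by dimension; the character would then be real. -/
theorem integral_character_sq_eq_zero (hρ : ρ.ContinuousCoeff) (hirr : ρ.IsIrreducible)
    (hnr : ∃ g, (ρ.character g).im ≠ 0) : ∫ g, ρ.character g ^ 2 ∂μ = 0 := by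
  have h1 : ∀ g, ρ.character g ^ 2 = conj (ρ.conjRep.character g) * ρ.character g := fun g => by
    rw [conjRep_character, Complex.conj_conj, sq]
  simp only [h1]
  rw [integral_character_mul_conj μ hρ.conjRep hρ]
  have h2 : Subsingleton (IntertwiningMap ρ.conjRep ρ) := by
    refine ⟨fun f f' => sub_eq_zero.1 ?_⟩
    refine (IsIrreducible.surjective_or_eq_zero (f - f')).resolve_left fun hs => ?_
    obtain ⟨g, hg⟩ := hnr
    have hdim : Module.finrank ℂ (ConjSpace V) = Module.finrank ℂ V := by
      rw [(conjEquivFun (Module.finBasis ℂ V)).finrank_eq, Module.finrank_fin_fun]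
    have hinj := (LinearMap.injective_iff_surjective_of_finrank_eq_finrank hdim
      (f := (f - f').toLinearMap)).2 hs
    have h3 := congrFun (char_iso ((f - f').ofBijective ⟨hinj, hs⟩)) g
    rw [conjRep_character] at h3
    exact hg (Complex.conj_eq_iff_im.1 h3)
  rw [Module.finrank_zero_of_subsingleton]
  simp

/-- The average of ρ(hαh⁻¹) over h commutes with G, so it is a scalar by Schur's lemma; its trace
identifies the scalar as the character ratio. -/
theorem integral_character_mul_conj_apply (hρ : ρ.ContinuousCoeff) (hirr : ρ.IsIrreducible)
    (g α : G) : ∫ h, ρ.character (g * (h * α * h⁻¹)) ∂μ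
      = ρ.character g * (ρ.character α / (Module.finrank ℂ V : ℂ)) := by
  have hTc : ∀ (f : Module.Dual ℂ V) (v : V), Continuous fun h => f (ρ (h * α * h⁻¹) v) :=
    fun f v => (hρ f v).comp (by fun_prop)
  obtain ⟨Q, hQ, htr⟩ := exists_weak_integral μ (T := fun h => ρ (h * α * h⁻¹)) hTc
  have hcomm : ∀ g, Q ∘ₗ ρ g = ρ g ∘ₗ Q := fun g => by
    ext v
    rw [← sub_eq_zero, ← Module.forall_dual_apply_eq_zero_iff ℂ]
    intro f
    have h1 := hQ (f ∘ₗ ρ g) v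
    simp only [LinearMap.comp_apply] at h1
    rw [map_sub, LinearMap.comp_apply, LinearMap.comp_apply, h1, hQ]
    have h2 : ∀ h, f (ρ g (ρ (h * α * h⁻¹) v))
        = f (ρ ((g * h) * α * (g * h)⁻¹) (ρ g v)) := fun h => by
      rw [← Module.End.mul_apply, ← Module.End.mul_apply, ← map_mul, ← map_mul]
      congr 3
      group
    simp only [h2]
    rw [integral_mul_left_eq_self (fun h => f (ρ (h * α * h⁻¹) (ρ g v))) g, sub_self]
  let q : IntertwiningMap ρ ρ := ⟨Q, hcomm⟩
  obtain ⟨c, hc⟩ := (IsIrreducible.algebraMap_intertwiningMap_bijective_of_isAlgClosed).2 q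
  have hQc : Q = c • (1 : Module.End ℂ V) := by
    have := congrArg IntertwiningMap.toLinearMap hc
    exact this.symm
  have hcα : c * (Module.finrank ℂ V : ℂ) = ρ.character α := by
    have h1 := htr 1
    simp only [one_mul] at h1
    have h2 : ∀ h, LinearMap.trace ℂ V (ρ (h * α * h⁻¹)) = ρ.character α := fun h =>
      char_conj ρ α h
    simp only [h2] at h1
    rw [hQc, map_smul, LinearMap.trace_one] at h1
    simpa using h1
  have hn : (Module.finrank ℂ V : ℂ) ≠ 0 := by
    have := (isIrreducible_iff_forall_submodule.1 hirr).1
    exact_mod_cast Module.finrank_pos.ne'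
  have h1 := htr (ρ g)
  have h2 : ∀ h, LinearMap.trace ℂ V (ρ g * ρ (h * α * h⁻¹))
      = ρ.character (g * (h * α * h⁻¹)) := fun h => by
    rw [← map_mul]
    rfl
  simp only [h2] at h1
  rw [← h1, hQc, mul_smul_comm, mul_one, map_smul, smul_eq_mul, ← hcα, mul_div_cancel_right₀ _ hn,
    mul_comm]
  rfl

end Haar

end Representation

/-! ### Characters as sums of irreducible characters. -/

section Decomposition

universe u

variable {G : Type*} [Group G] [TopologicalSpace G]

theorem IrrepModel.exists_equiv {W : Type*} [AddCommGroup W] [Module ℂ W]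
    [FiniteDimensional ℂ W] {ρ : Representation ℂ G W} (hρ : ρ.ContinuousCoeff)
    (hirr : ρ.IsIrreducible) : ∃ σ : IrrepModel G, Nonempty (ρ.Equiv σ.rep) := by
  let e := (Module.finBasis ℂ W).equivFun
  let r : Representation ℂ G (Fin (Module.finrank ℂ W) → ℂ) :=
    { toFun := fun g => e.toLinearMap ∘ₗ ρ g ∘ₗ e.symm.toLinearMap
      map_one' := by
        ext v
        simp
      map_mul' := fun g h => by
        ext v
        simp }
  let E : ρ.Equiv r := Representation.Equiv.mk e fun g => by
    ext v
    simp [r]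
  exact ⟨⟨_, r, (hρ.of_equiv E).isContinuousAction_pi, hirr.of_equiv E⟩, ⟨E⟩⟩

theorem IrrepModel.continuousCoeff (σ : IrrepModel G) : σ.rep.ContinuousCoeff :=
  σ.continuous_rep.continuousCoeff

/-- Induction on dimension: traces add over an invariant subspace and its quotient, so no invariant
complement is needed. -/
theorem Representation.exists_multiset_character {W : Type u} [AddCommGroup W] [Module ℂ W]
    [FiniteDimensional ℂ W] {ρ : Representation ℂ G W} (hρ : ρ.ContinuousCoeff) :
    ∃ s : Multiset (Irr G), ∀ g, ρ.character g = (s.map fun φ => φ.char g).sum := by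
  suffices H : ∀ (n : ℕ) (W : Type u) [AddCommGroup W] [Module ℂ W] [FiniteDimensional ℂ W]
      (ρ : Representation ℂ G W), ρ.ContinuousCoeff → Module.finrank ℂ W = n →
      ∃ s : Multiset (Irr G), ∀ g, ρ.character g = (s.map fun φ => φ.char g).sum from
    H _ W ρ hρ rfl
  intro n
  induction n using Nat.strong_induction_on with
  | _ n ih =>
    intro W _ _ _ ρ hρ hn
    by_cases hirr : ρ.IsIrreducible
    · obtain ⟨σ, ⟨e⟩⟩ := IrrepModel.exists_equiv hρ hirr
      let φ : Irr G := Quotient.mk _ σ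
      refine ⟨{φ}, fun g => ?_⟩
      rw [Multiset.map_singleton, Multiset.sum_singleton, Representation.char_iso e]
      rfl
    · rw [isIrreducible_iff_forall_submodule, not_and_or] at hirr
      rcases hirr with hW | hU
      · rw [not_nontrivial_iff_subsingleton] at hW
        refine ⟨0, fun g => ?_⟩
        rw [Multiset.map_zero, Multiset.sum_zero, Representation.character,
          Subsingleton.elim (ρ g) 0, map_zero]
      · push Not at hU
        obtain ⟨U, hU, hbot, htop⟩ := hU
        have h1 : Module.finrank ℂ U < n := hn ▸ Submodule.finrank_lt htop
        have h2 : Module.finrank ℂ (W ⧸ U) < n := by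
          have h3 := U.finrank_quotient_add_finrank
          have h4 : Module.finrank ℂ U ≠ 0 := fun h => hbot (Submodule.finrank_eq_zero.1 h)
          omega
        obtain ⟨s, hs⟩ := ih _ h1 U _ (hρ.subrepresentation U hU) rfl
        obtain ⟨t, ht⟩ := ih _ h2 (W ⧸ U) _ (hρ.quotient U hU) rfl
        refine ⟨s + t, fun g => ?_⟩
        rw [Multiset.map_add, Multiset.sum_add, ← hs, ← ht]
        exact LinearMap.trace_eq_trace_restrict_add_trace_mapQ U (ρ g) (hU g)

end Decomposition

/-! ### Irreducible classes: orthonormality and multiplicities. -/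

namespace Irr

variable {G : Type*} [Group G] [TopologicalSpace G]

theorem continuous_char (φ : Irr G) : Continuous φ.char := by
  induction φ using Quotient.ind with
  | _ σ => exact σ.continuousCoeff.continuous_character

theorem exists_isTriv : ∃ φ : Irr G, φ.IsTriv := by
  have hirr : (Representation.trivial ℂ G (Fin 1 → ℂ)).IsIrreducible := by
    rw [Representation.isIrreducible_iff_forall_submodule]
    refine ⟨inferInstance, fun U _ => ?_⟩
    have : IsSimpleOrder (Submodule ℂ (Fin 1 → ℂ)) := by
      rw [← isSimpleModule_iff, isSimpleModule_iff_finrank_eq_one]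
      simp
    exact eq_bot_or_eq_top U
  exact ⟨⟦⟨1, Representation.trivial ℂ G (Fin 1 → ℂ), continuous_snd, hirr⟩⟧, fun _ _ => rfl⟩

/-- Every line is invariant under a trivial action, so irreducibility forces dimension one. -/
theorem IsTriv.char_eq_one {φ : Irr G} (h : φ.IsTriv) (g : G) : φ.char g = 1 ∧ φ.dim = 1 := by
  induction φ using Quotient.ind with
  | _ σ =>
    have h1 : ∀ g v, σ.rep g v = v := h
    obtain ⟨hnt, hsub⟩ := Representation.isIrreducible_iff_forall_submodule.1 σ.irreducible_rep
    obtain ⟨v, hv⟩ := exists_ne (0 : Fin σ.n → ℂ)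
    have hdim : Module.finrank ℂ (Fin σ.n → ℂ) = 1 := by
      rcases hsub (ℂ ∙ v) fun g w hw => by
        rw [Submodule.mem_comap, h1]
        exact hw with h2 | h2
      · exact absurd (Submodule.span_singleton_eq_bot.1 h2) hv
      · rw [← finrank_top, ← h2, finrank_span_singleton hv]
    refine ⟨?_, hdim⟩
    show LinearMap.trace ℂ _ (σ.rep g) = 1
    have h3 : σ.rep g = 1 := LinearMap.ext fun v => h1 g v
    rw [h3, LinearMap.trace_one, hdim, Nat.cast_one]

variable [IsTopologicalGroup G] [CompactSpace G] [MeasurableSpace G] [BorelSpace G]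
  (μ : Measure G) [μ.IsHaarMeasure] [IsProbabilityMeasure μ]

theorem integral_char_mul_conj_apply (φ : Irr G) (g α : G) :
    ∫ h, φ.char (g * (h * α * h⁻¹)) ∂μ = φ.char g * φ.charRatio α := by
  induction φ using Quotient.ind with
  | _ σ =>
    exact Representation.integral_character_mul_conj_apply μ σ.continuousCoeff
      σ.irreducible_rep g α

open scoped Classical in
theorem integral_conj_char_mul_char (φ ψ : Irr G) :
    ∫ g, conj (φ.char g) * ψ.char g ∂μ = if φ = ψ then 1 else 0 := by
  split_ifs with h
  · subst h
    induction φ using Quotient.ind with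
    | _ σ =>
      exact Representation.integral_character_mul_conj_self μ σ.continuousCoeff σ.irreducible_rep
  · induction φ using Quotient.ind with
    | _ σ =>
      induction ψ using Quotient.ind with
      | _ ρ =>
        have hs := σ.irreducible_rep
        have hr := ρ.irreducible_rep
        have hemp : IsEmpty (σ.rep.Equiv ρ.rep) := ⟨fun e => h (Quotient.sound ⟨e⟩)⟩
        refine (Representation.integral_character_mul_conj μ σ.continuousCoeff
          ρ.continuousCoeff).trans ?_
        rw [Module.finrank_zero_of_subsingleton, Nat.cast_zero]

variable {W : Type*} [AddCommGroup W] [Module ℂ W] [FiniteDimensional ℂ W]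
  {ρ : Representation ℂ G W}

theorem integral_conj_char_mul_character (hρ : ρ.ContinuousCoeff) (φ : Irr G) :
    ∫ g, conj (φ.char g) * ρ.character g ∂μ = φ.mult ρ := by
  induction φ using Quotient.ind with
  | _ σ => exact Representation.integral_character_mul_conj μ σ.continuousCoeff hρ

include μ in
/-- The isotypic decomposition at the level of characters. -/
theorem exists_finset_character_eq (hρ : ρ.ContinuousCoeff) :
    ∃ s : Finset (Irr G), (∀ φ, φ ∉ s → φ.mult ρ = 0) ∧
      ∀ g, ρ.character g = ∑ φ ∈ s, (φ.mult ρ : ℂ) * φ.char g := by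
  classical
  obtain ⟨s, hs⟩ := Representation.exists_multiset_character hρ
  have h1 : ∀ g, ρ.character g = ∑ ψ ∈ s.toFinset, (s.count ψ : ℂ) * ψ.char g := fun g => by
    rw [hs, Finset.sum_multiset_map_count]
    simp only [nsmul_eq_mul]
  -- Pairing the decomposition with χ^φ evaluates both sides: orthonormality yields the count, the
  -- Hom-space formula the multiplicity.
  have h2 : ∀ φ : Irr G, φ.mult ρ = s.count φ := fun φ => by
    have h3 := integral_conj_char_mul_character μ hρ φ
    have h4 : ∀ g, conj (φ.char g) * ρ.character g
        = ∑ ψ ∈ s.toFinset, (s.count ψ : ℂ) * (conj (φ.char g) * ψ.char g) := fun g => by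
      rw [h1, Finset.mul_sum]
      exact Finset.sum_congr rfl fun ψ _ => by ring
    simp only [h4] at h3
    rw [integral_finsetSum] at h3
    · simp only [integral_const_mul, integral_conj_char_mul_char] at h3
      simp only [mul_ite, mul_one, mul_zero, Finset.sum_ite_eq, Multiset.mem_toFinset] at h3
      split_ifs at h3 with h5
      · exact_mod_cast h3.symm
      · rw [Multiset.count_eq_zero_of_notMem h5]
        exact_mod_cast h3.symm
    · intro ψ _
      exact Continuous.integrable_of_compactSpace
        (continuous_const.mul ((Complex.continuous_conj.comp φ.continuous_char).mul
          ψ.continuous_char))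
  refine ⟨s.toFinset, fun φ hφ => ?_, fun g => ?_⟩
  · rw [h2, Multiset.count_eq_zero]
    simpa using hφ
  · simp only [h2]
    exact h1 g

include μ in
theorem eq_of_isTriv {φ ψ : Irr G} (hφ : φ.IsTriv) (hψ : ψ.IsTriv) : φ = ψ := by
  by_contra hne
  have h := integral_conj_char_mul_char μ φ ψ
  simp [hne, (hφ.char_eq_one _).1, (hψ.char_eq_one _).1] at h

end Irr

/-- A right translate of Haar measure is again a Haar probability measure, hence the same one. -/
theorem MeasureTheory.Measure.isMulRightInvariant_of_compactSpace {G : Type*} [Group G]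
    [TopologicalSpace G] [IsTopologicalGroup G] [CompactSpace G] [MeasurableSpace G]
    [BorelSpace G] (μ : Measure G) [μ.IsHaarMeasure] [IsProbabilityMeasure μ] :
    μ.IsMulRightInvariant where
  map_mul_right_eq_self g := by
    have : IsProbabilityMeasure (μ.map (· * g)) :=
      Measure.isProbabilityMeasure_map (by fun_prop)
    exact Measure.isHaarMeasure_eq_of_isProbabilityMeasure _ _

theorem sq_integral_abs_le_integral_sq {Ω : Type*} [TopologicalSpace Ω] [CompactSpace Ω]
    [MeasurableSpace Ω] [BorelSpace Ω] {P : Measure Ω} [IsProbabilityMeasure P] {u : Ω → ℝ}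
    (hu : Continuous u) : (∫ p, |u p| ∂P) ^ 2 ≤ ∫ p, u p ^ 2 ∂P := by
  set c := ∫ p, |u p| ∂P with hc
  have h1 : 0 ≤ ∫ p, (|u p| - c) ^ 2 ∂P := integral_nonneg fun p => sq_nonneg _
  have h2 : ∀ p, (|u p| - c) ^ 2 = u p ^ 2 - 2 * c * |u p| + c ^ 2 := fun p => by
    rw [sub_sq, sq_abs]
    ring
  simp only [h2] at h1
  rw [integral_add (Continuous.integrable_of_compactSpace (by fun_prop)) (integrable_const _),
    integral_sub (Continuous.integrable_of_compactSpace (by fun_prop))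
      (Continuous.integrable_of_compactSpace (by fun_prop)), integral_const_mul, ← hc] at h1
  simp only [integral_const, probReal_univ, one_smul] at h1
  linarith

/-! ### The character of (τ + τ̄)² and its relation to W². -/

namespace Representation

variable {G V : Type*} [Group G] [AddCommGroup V] [Module ℂ V] [FiniteDimensional ℂ V]

theorem sumConjSq_character (τ : Representation ℂ G V) (g : G) :
    τ.sumConjSq.character g = (τ.character g + conj (τ.character g)) ^ 2 := by
  have h : (τ.prod τ.conjRep).character g = τ.character g + conj (τ.character g) := by
    rw [← conjRep_character]
    exact LinearMap.trace_prodMap' (τ g) (τ.conjRep g)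
  rw [sumConjSq, char_tensor, Pi.mul_apply, h, sq]

omit [FiniteDimensional ℂ V] in
theorem ofReal_symmTrace (τ : Representation ℂ G V) (g : G) :
    (τ.symmTrace g : ℂ) = (τ.character g + conj (τ.character g)) / (√2 : ℝ) := by
  rw [symmTrace, Complex.ofReal_div]
  congr 1
  rw [Complex.add_conj]
  simp

theorem ofReal_symmTrace_sq (τ : Representation ℂ G V) (g : G) :
    ((τ.symmTrace g ^ 2 : ℝ) : ℂ) = 1 / 2 * τ.sumConjSq.character g := by
  rw [Complex.ofReal_pow, ofReal_symmTrace, sumConjSq_character, div_pow, ← Complex.ofReal_pow,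
    Real.sq_sqrt (by norm_num)]
  push_cast
  ring

theorem ContinuousCoeff.continuous_symmTrace [TopologicalSpace G] {τ : Representation ℂ G V}
    (hτ : τ.ContinuousCoeff) : Continuous τ.symmTrace := by
  have h := hτ.continuous_character
  exact (Complex.continuous_re.comp (h.add (Complex.continuous_conj.comp h))).div_const _

theorem ContinuousCoeff.sumConjSq [TopologicalSpace G] {τ : Representation ℂ G V}
    (hτ : τ.ContinuousCoeff) : τ.sumConjSq.ContinuousCoeff :=
  (hτ.prod hτ.conjRep).tprod (hτ.prod hτ.conjRep)

end Representation

/-! ### The exchangeable pair from multiplication by a random conjugate of α. -/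

section RandomConjugate

variable {G : Type*} [Group G] [TopologicalSpace G] [IsTopologicalGroup G] [CompactSpace G]
  [SecondCountableTopology G] [MeasurableSpace G] [BorelSpace G] (μ : Measure G)
  [μ.IsHaarMeasure] [IsProbabilityMeasure μ]

omit [SecondCountableTopology G] in
-- Parseval: u is real, so it may be conjugated before the orthonormality relations are applied.
theorem Irr.integral_mul_eq_sum {s : Finset (Irr G)} {c d : Irr G → ℝ} {u v : G → ℝ}
    (hu : ∀ g, (u g : ℂ) = ∑ φ ∈ s, (c φ : ℂ) * φ.char g)
    (hv : ∀ g, (v g : ℂ) = ∑ φ ∈ s, (d φ : ℂ) * φ.char g) :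
    ∫ g, u g * v g ∂μ = ∑ φ ∈ s, c φ * d φ := by
  classical
  have hi : ∀ φ ψ : Irr G, Integrable
      (fun g => (c φ * d ψ : ℂ) * (conj (φ.char g) * ψ.char g)) μ := fun φ ψ =>
    Continuous.integrable_of_compactSpace (continuous_const.mul
      ((Complex.continuous_conj.comp φ.continuous_char).mul ψ.continuous_char))
  have h1 : ∀ g, ((u g * v g : ℝ) : ℂ)
      = ∑ φ ∈ s, ∑ ψ ∈ s, (c φ * d ψ : ℂ) * (conj (φ.char g) * ψ.char g) := fun g => by
    rw [Complex.ofReal_mul, ← Complex.conj_ofReal (u g), hu, hv, map_sum, Finset.sum_mul_sum]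
    refine Finset.sum_congr rfl fun φ _ => Finset.sum_congr rfl fun ψ _ => ?_
    rw [map_mul, Complex.conj_ofReal]
    ring
  have h2 : ((∫ g, u g * v g ∂μ : ℝ) : ℂ) = ((∑ φ ∈ s, c φ * d φ : ℝ) : ℂ) := by
    rw [← integral_complex_ofReal]
    simp only [h1]
    rw [integral_finsetSum _ fun φ _ => integrable_finsetSum _ fun ψ _ => hi φ ψ]
    rw [Complex.ofReal_sum]
    refine Finset.sum_congr rfl fun φ hφ => ?_
    rw [integral_finsetSum _ fun ψ _ => hi φ ψ]
    simp only [integral_const_mul, Irr.integral_conj_char_mul_char, mul_ite, mul_one, mul_zero,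
      Finset.sum_ite_eq, hφ, if_true]
    push_cast
    rfl
  exact_mod_cast h2

theorem integral_conj_exchange {α : G} (hα : IsConj α α⁻¹) {K : G → G → ℝ}
    (hK : Continuous fun p : G × G => K p.1 p.2) :
    ∫ p : G × G, K p.1 (p.1 * (p.2 * α * p.2⁻¹)) ∂(μ.prod μ)
      = ∫ p : G × G, K (p.1 * (p.2 * α * p.2⁻¹)) p.1 ∂(μ.prod μ) := by
  have := μ.isMulRightInvariant_of_compactSpace
  obtain ⟨k, hk⟩ := isConj_iff.1 hα
  have hc1 : Continuous fun p : G × G => K p.1 (p.1 * (p.2 * α * p.2⁻¹)) :=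
    hK.comp (show Continuous fun p : G × G => (p.1, p.1 * (p.2 * α * p.2⁻¹)) by fun_prop)
  have hc2 : Continuous fun p : G × G => K (p.1 * (p.2 * α * p.2⁻¹)) p.1 :=
    hK.comp (show Continuous fun p : G × G => (p.1 * (p.2 * α * p.2⁻¹), p.1) by fun_prop)
  rw [integral_prod_symm _ hc1.integrable_of_compactSpace,
    integral_prod_symm _ hc2.integrable_of_compactSpace]
  -- Translating g by hαh⁻¹ swaps the arguments of K and replaces α by α⁻¹ = kαk⁻¹; the k is later
  -- absorbed into h by right invariance.
  have h1 : ∀ h, ∫ g, K (g * (h * α * h⁻¹)) g ∂μ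
      = ∫ g, K g (g * ((h * k) * α * (h * k)⁻¹)) ∂μ := fun h => by
    rw [← integral_mul_right_eq_self (fun g => K g (g * ((h * k) * α * (h * k)⁻¹)))
      (h * α * h⁻¹)]
    congr 1
    ext g
    congr 1
    have h2 : h * k * α * (h * k)⁻¹ = h * α⁻¹ * h⁻¹ := by
      rw [← hk]
      group
    rw [h2]
    group
  simp only [h1]
  exact (integral_mul_right_eq_self (fun h => ∫ g, K g (g * (h * α * h⁻¹)) ∂μ) k).symm

variable {V : Type*} [AddCommGroup V] [Module ℂ V] [FiniteDimensional ℂ V]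
  {τ : Representation ℂ G V}

omit [SecondCountableTopology G] in
theorem Representation.integral_symmTrace_mul_conj_apply (hτ : τ.ContinuousCoeff)
    (hirr : τ.IsIrreducible) {α : G} {a : ℝ}
    (ha : τ.character α / (Module.finrank ℂ V : ℂ) = ((1 - a : ℝ) : ℂ)) (g : G) :
    ∫ h, τ.symmTrace (g * (h * α * h⁻¹)) ∂μ = (1 - a) * τ.symmTrace g := by
  have hχ := hτ.continuous_character
  have hc : Continuous fun h => τ.character (g * (h * α * h⁻¹)) := hχ.comp (by fun_prop)
  have h1 : ((∫ h, τ.symmTrace (g * (h * α * h⁻¹)) ∂μ : ℝ) : ℂ)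
      = (((1 - a) * τ.symmTrace g : ℝ) : ℂ) := by
    rw [← integral_complex_ofReal]
    simp only [ofReal_symmTrace]
    have hc' : Integrable (fun h => conj (τ.character (g * (h * α * h⁻¹)))) μ :=
      (Complex.continuous_conj.comp hc).integrable_of_compactSpace
    rw [integral_div, integral_add hc.integrable_of_compactSpace hc', integral_conj,
      integral_character_mul_conj_apply μ hτ hirr, ha, map_mul, Complex.conj_ofReal,
      Complex.ofReal_mul, ofReal_symmTrace]
    ring
  exact_mod_cast h1

omit [SecondCountableTopology G] in
-- In (χ + χ̄)² = χ² + χ̄² + 2|χ|² the squares average to 0 because χ is not real valued, and |χ|²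
-- averages to 1.
theorem Representation.integral_symmTrace_sq (hτ : τ.ContinuousCoeff)
    (hirr : τ.IsIrreducible) (hnr : ∃ g, (τ.character g).im ≠ 0) :
    ∫ g, τ.symmTrace g ^ 2 ∂μ = 1 := by
  have hχ := hτ.continuous_character
  have hχ' := Complex.continuous_conj.comp hχ
  have h1 : ((∫ g, τ.symmTrace g ^ 2 ∂μ : ℝ) : ℂ) = 1 := by
    rw [← integral_complex_ofReal]
    simp only [ofReal_symmTrace_sq, sumConjSq_character]
    have h2 : ∀ g, (τ.character g + conj (τ.character g)) ^ 2
        = (τ.character g ^ 2 + conj (τ.character g ^ 2))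
          + 2 * (conj (τ.character g) * τ.character g) := fun g => by
      rw [map_pow]
      ring
    have hi1 : Integrable (fun g => τ.character g ^ 2) μ :=
      (hχ.pow 2).integrable_of_compactSpace
    have hi2 : Integrable (fun g => conj (τ.character g ^ 2)) μ :=
      (Complex.continuous_conj.comp (hχ.pow 2)).integrable_of_compactSpace
    have hi3 : Integrable (fun g => 2 * (conj (τ.character g) * τ.character g)) μ :=
      (continuous_const.mul (hχ'.mul hχ)).integrable_of_compactSpace
    simp only [h2]
    have hi4 : Integrable (fun g => τ.character g ^ 2 + conj (τ.character g ^ 2)) μ := hi1.add hi2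
    rw [integral_const_mul, integral_add hi4 hi3, integral_add hi1 hi2, integral_conj,
      integral_character_sq_eq_zero μ hτ hirr hnr, integral_const_mul,
      integral_character_mul_conj_self μ hτ hirr]
    simp
  exact_mod_cast h1

theorem Representation.isSteinPair_symmTrace (hτ : τ.ContinuousCoeff) (hirr : τ.IsIrreducible)
    (hnr : ∃ g, (τ.character g).im ≠ 0) {α : G} (hα : IsConj α α⁻¹) {a : ℝ}
    (ha : τ.character α / (Module.finrank ℂ V : ℂ) = ((1 - a : ℝ) : ℂ)) :
    IsSteinPair (μ.prod μ) (fun p : G × G => τ.symmTrace p.1)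
      (fun p : G × G => τ.symmTrace (p.1 * (p.2 * α * p.2⁻¹))) a := by
  have hW := hτ.continuous_symmTrace
  have hX : Continuous fun p : G × G => τ.symmTrace p.1 := by fun_prop
  have hY : Continuous fun p : G × G => τ.symmTrace (p.1 * (p.2 * α * p.2⁻¹)) := by fun_prop
  have hex : ∀ F : ℝ × ℝ → ℝ, Continuous F →
      ∫ p : G × G, F (τ.symmTrace p.1, τ.symmTrace (p.1 * (p.2 * α * p.2⁻¹))) ∂(μ.prod μ)
      = ∫ p : G × G, F (τ.symmTrace (p.1 * (p.2 * α * p.2⁻¹)), τ.symmTrace p.1) ∂(μ.prod μ) :=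
    fun F hF => integral_conj_exchange μ hα
      (K := fun g g' => F (τ.symmTrace g, τ.symmTrace g')) (by fun_prop)
  have hreg : ∀ f : ℝ → ℝ, Continuous f →
      ∫ p : G × G, f (τ.symmTrace p.1)
        * (τ.symmTrace (p.1 * (p.2 * α * p.2⁻¹)) - τ.symmTrace p.1) ∂(μ.prod μ)
      = -a * ∫ p : G × G, f (τ.symmTrace p.1) * τ.symmTrace p.1 ∂(μ.prod μ) := by
    intro f hf
    rw [integral_prod _ (Continuous.integrable_of_compactSpace (by fun_prop)),
      integral_prod _ (Continuous.integrable_of_compactSpace (by fun_prop)),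
      ← integral_const_mul]
    congr 1
    ext g
    dsimp only
    have hc : Continuous fun h => τ.symmTrace (g * (h * α * h⁻¹)) := by fun_prop
    rw [integral_const_mul, integral_sub hc.integrable_of_compactSpace (integrable_const _),
      integral_symmTrace_mul_conj_apply μ hτ hirr ha]
    simp only [integral_const, probReal_univ, one_smul]
    ring
  refine ⟨hX, hY, hex, hreg, ?_⟩
  have hX2 : ∫ p : G × G, τ.symmTrace p.1 ^ 2 ∂(μ.prod μ) = 1 := by
    rw [integral_prod _ (Continuous.integrable_of_compactSpace (by fun_prop))]
    simp only [integral_const, probReal_univ, one_smul]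
    exact integral_symmTrace_sq μ hτ hirr hnr
  have hY2 := hex (fun x => x.1 ^ 2) (by fun_prop)
  have h1 := hreg (fun x => x) continuous_id
  dsimp only at hY2 h1
  rw [hX2] at hY2
  simp only [← sq, hX2] at h1
  -- E Y² and E X² cancel by exchangeability, and regression turns -2 E X(Y - X) into 2a E X² = 2a.
  have h2 : ∀ p : G × G, (τ.symmTrace (p.1 * (p.2 * α * p.2⁻¹)) - τ.symmTrace p.1) ^ 2
      = τ.symmTrace (p.1 * (p.2 * α * p.2⁻¹)) ^ 2 - τ.symmTrace p.1 ^ 2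
        - 2 * (τ.symmTrace p.1
          * (τ.symmTrace (p.1 * (p.2 * α * p.2⁻¹)) - τ.symmTrace p.1)) := fun p => by ring
  simp only [h2]
  rw [integral_sub (Continuous.integrable_of_compactSpace (by fun_prop))
      (Continuous.integrable_of_compactSpace (by fun_prop)),
    integral_sub (Continuous.integrable_of_compactSpace (by fun_prop))
      (Continuous.integrable_of_compactSpace (by fun_prop)), integral_const_mul, hX2, ← hY2, h1]
  ring

end RandomConjugate

/-- Expand: E Y⁴ = E X⁴ and E Y³X = E X³Y by exchangeability, and E X³Y = (1 - a) E X⁴ by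
regression, so E X⁴ gets 2 - 8(1 - a). -/
theorem IsSteinPair.integral_pow_four {Ω : Type*} [TopologicalSpace Ω] [CompactSpace Ω]
    [MeasurableSpace Ω] [BorelSpace Ω] {P : Measure Ω} [IsProbabilityMeasure P] {X Y : Ω → ℝ}
    {a : ℝ} (h : IsSteinPair P X Y a) :
    ∫ p, (Y p - X p) ^ 4 ∂P
      = (8 * a - 6) * ∫ p, X p ^ 4 ∂P + 6 * ∫ p, X p ^ 2 * Y p ^ 2 ∂P := by
  have hX := h.continuous_fst
  have hY := h.continuous_snd
  have h1 := h.exchangeable (fun x => x.1 ^ 4) (by fun_prop)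
  have h2 := h.exchangeable (fun x => x.1 ^ 3 * x.2) (by fun_prop)
  have h3 := h.regression (fun x => x ^ 3) (by fun_prop)
  dsimp only at h1 h2 h3
  have h4 : ∫ p, X p ^ 3 * (Y p - X p) ∂P
      = ∫ p, X p ^ 3 * Y p ∂P - ∫ p, X p ^ 4 ∂P := by
    rw [← integral_sub (Continuous.integrable_of_compactSpace (by fun_prop))
      (Continuous.integrable_of_compactSpace (by fun_prop))]
    congr 1
    ext p
    ring
  have h5 : ∀ p, X p ^ 3 * X p = X p ^ 4 := fun p => by ring
  simp only [h5] at h3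
  have h6 : ∀ p, (Y p - X p) ^ 4 = Y p ^ 4 + X p ^ 4 - 4 * (Y p ^ 3 * X p)
      - 4 * (X p ^ 3 * Y p) + 6 * (X p ^ 2 * Y p ^ 2) := fun p => by ring
  simp only [h6]
  rw [integral_add (Continuous.integrable_of_compactSpace (by fun_prop))
      (Continuous.integrable_of_compactSpace (by fun_prop)),
    integral_sub (Continuous.integrable_of_compactSpace (by fun_prop))
      (Continuous.integrable_of_compactSpace (by fun_prop)),
    integral_sub (Continuous.integrable_of_compactSpace (by fun_prop))
      (Continuous.integrable_of_compactSpace (by fun_prop)),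
    integral_add (Continuous.integrable_of_compactSpace (by fun_prop))
      (Continuous.integrable_of_compactSpace (by fun_prop)),
    integral_const_mul, integral_const_mul, integral_const_mul, ← h1, ← h2]
  linarith

/-! ### Evaluating Stein's bound by character sums. -/

section CharacterApproximation

variable {G : Type*} [Group G] [TopologicalSpace G] [IsTopologicalGroup G] [CompactSpace G]
  [MeasurableSpace G] [BorelSpace G] (μ : Measure G)
  [μ.IsHaarMeasure] [IsProbabilityMeasure μ]
  {V : Type*} [AddCommGroup V] [Module ℂ V] [FiniteDimensional ℂ V]
  {τ : Representation ℂ G V} {α : G}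

include μ in
theorem Representation.ContinuousCoeff.character_im_eq_zero (hτ : τ.ContinuousCoeff)
    (hα : IsConj α α⁻¹) : (τ.character α).im = 0 := by
  obtain ⟨k, hk⟩ := isConj_iff.1 hα
  have h1 := Representation.character_inv μ hτ α
  rw [← hk, Representation.char_conj] at h1
  exact Complex.conj_eq_iff_im.1 h1.symm

include μ in
theorem Irr.charRatio_im_eq_zero (φ : Irr G) (hα : IsConj α α⁻¹) :
    (φ.charRatio α).im = 0 := by
  have h : (φ.char α).im = 0 := by
    induction φ using Quotient.ind with
    | _ σ => exact σ.continuousCoeff.character_im_eq_zero μ hα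
  rw [Irr.charRatio, Complex.div_natCast_im, h, zero_div]

theorem Representation.integral_symmTrace_conj_apply_sq
    (hα : IsConj α α⁻¹) {s : Finset (Irr G)}
    (hs : ∀ g, τ.sumConjSq.character g = ∑ φ ∈ s, (φ.mult τ.sumConjSq : ℂ) * φ.char g) (g : G) :
    ((∫ h, τ.symmTrace (g * (h * α * h⁻¹)) ^ 2 ∂μ : ℝ) : ℂ)
      = ∑ φ ∈ s, ((1 / 2 * (φ.mult τ.sumConjSq : ℝ) * (φ.charRatio α).re : ℝ) : ℂ) * φ.char g := by
  rw [← integral_complex_ofReal]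
  simp only [ofReal_symmTrace_sq, hs]
  rw [integral_const_mul, integral_finsetSum]
  · rw [Finset.mul_sum]
    refine Finset.sum_congr rfl fun φ _ => ?_
    have h1 : φ.charRatio α = ((φ.charRatio α).re : ℂ) :=
      Complex.ext rfl (by simp [φ.charRatio_im_eq_zero μ hα])
    rw [integral_const_mul, Irr.integral_char_mul_conj_apply, h1]
    push_cast
    simp only [Complex.ofReal_re]
    ring
  · intro φ _
    exact Continuous.integrable_of_compactSpace
      (continuous_const.mul (φ.continuous_char.comp (by fun_prop)))

include μ in
-- The multiplicity is the mean of the character 2W², and E W² = 1.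
theorem Representation.mult_sumConjSq_of_isTriv (hτ : τ.ContinuousCoeff)
    (hirr : τ.IsIrreducible) (hnr : ∃ g, (τ.character g).im ≠ 0) {φ : Irr G} (hφ : φ.IsTriv) :
    φ.mult τ.sumConjSq = 2 := by
  have h1 := Irr.integral_conj_char_mul_character μ hτ.sumConjSq φ
  have h2 : ∀ g, conj (φ.char g) * τ.sumConjSq.character g
      = ((2 * τ.symmTrace g ^ 2 : ℝ) : ℂ) := fun g => by
    rw [(hφ.char_eq_one g).1, Complex.ofReal_mul, ofReal_symmTrace_sq, map_one]
    push_cast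
    ring
  simp only [h2] at h1
  rw [integral_complex_ofReal, integral_const_mul, integral_symmTrace_sq μ hτ hirr hnr] at h1
  have h3 : ((φ.mult τ.sumConjSq : ℕ) : ℂ) = ((2 : ℕ) : ℂ) := by
    rw [← h1]
    norm_num
  exact_mod_cast h3

variable [SecondCountableTopology G]

theorem Representation.abs_measureReal_symmTrace_sub_gaussCDF_le (hτ : τ.ContinuousCoeff)
    (hirr : τ.IsIrreducible) (hnr : ∃ g, (τ.character g).im ≠ 0) (hα : IsConj α α⁻¹) {a : ℝ}
    (ha : τ.character α / (Module.finrank ℂ V : ℂ) = ((1 - a : ℝ) : ℂ)) (ha0 : a ≠ 0)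
    {s : Finset (Irr G)}
    (hs : ∀ g, τ.sumConjSq.character g = ∑ φ ∈ s, (φ.mult τ.sumConjSq : ℂ) * φ.char g)
    {φ₀ : Irr G} (hφ₀ : φ₀.IsTriv) (hφ₀s : φ₀ ∈ s) [DecidableEq (Irr G)] (x : ℝ) :
    |μ.real {g | τ.symmTrace g ≤ x} - gaussCDF x|
      ≤ 1 / 2 * √(∑ φ ∈ s.erase φ₀, (φ.mult τ.sumConjSq : ℝ) ^ 2
            * (2 - 1 / a * (1 - (φ.charRatio α).re)) ^ 2)
        + (1 / Real.pi * ∑ φ ∈ s, (φ.mult τ.sumConjSq : ℝ) ^ 2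
            * (2 - 3 / (2 * a) * (1 - (φ.charRatio α).re))) ^ (1 / 4 : ℝ) := by
  have hpair := isSteinPair_symmTrace μ hτ hirr hnr hα ha
  -- 2a is a mean square, so a ≠ 0 already forces a > 0.
  have hapos : 0 < a := by
    have h1 := hpair.integral_sq
    have h2 : 0 ≤ 2 * a := h1 ▸ integral_nonneg fun p => sq_nonneg _
    exact lt_of_le_of_ne (by linarith) ha0.symm
  set m : Irr G → ℝ := fun φ => (φ.mult τ.sumConjSq : ℝ) with hm
  set r : Irr G → ℝ := fun φ => (φ.charRatio α).re with hr
  have hW := hτ.continuous_symmTrace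
  have hX : Continuous fun p : G × G => τ.symmTrace p.1 := by fun_prop
  have hY : Continuous fun p : G × G => τ.symmTrace (p.1 * (p.2 * α * p.2⁻¹)) := by fun_prop
  have hYg : ∀ g, Continuous fun h => τ.symmTrace (g * (h * α * h⁻¹)) := fun g => by fun_prop
  have hW2 : ∀ g, ((τ.symmTrace g ^ 2 : ℝ) : ℂ) = ∑ φ ∈ s, ((1 / 2 * m φ : ℝ) : ℂ) * φ.char g :=
    fun g => by
      rw [ofReal_symmTrace_sq, hs, Finset.mul_sum]
      refine Finset.sum_congr rfl fun φ _ => ?_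
      simp only [hm]
      push_cast
      ring
  have hY2 := integral_symmTrace_conj_apply_sq μ hα hs
  have hX4 : ∫ p : G × G, τ.symmTrace p.1 ^ 4 ∂(μ.prod μ) = 1 / 4 * ∑ φ ∈ s, m φ ^ 2 := by
    rw [integral_prod _ (Continuous.integrable_of_compactSpace (by fun_prop))]
    simp only [integral_const, probReal_univ, one_smul]
    have h1 := Irr.integral_mul_eq_sum μ hW2 hW2
    have h2 : ∀ g, τ.symmTrace g ^ 4 = τ.symmTrace g ^ 2 * τ.symmTrace g ^ 2 := fun g => by ring
    simp only [h2]
    rw [h1, Finset.mul_sum]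
    exact Finset.sum_congr rfl fun φ _ => by ring
  have hX2Y2 : ∫ p : G × G, τ.symmTrace p.1 ^ 2
      * τ.symmTrace (p.1 * (p.2 * α * p.2⁻¹)) ^ 2 ∂(μ.prod μ)
      = 1 / 4 * ∑ φ ∈ s, m φ ^ 2 * r φ := by
    rw [integral_prod _ (Continuous.integrable_of_compactSpace (by fun_prop))]
    simp only [integral_const_mul]
    rw [Irr.integral_mul_eq_sum μ hW2 hY2, Finset.mul_sum]
    exact Finset.sum_congr rfl fun φ _ => by simp only [hm, hr]; ring
  have h4 := hpair.integral_pow_four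
  rw [hX4, hX2Y2] at h4
  have h4' : (∫ p : G × G, (τ.symmTrace (p.1 * (p.2 * α * p.2⁻¹)) - τ.symmTrace p.1) ^ 4
      ∂(μ.prod μ)) / a = ∑ φ ∈ s, m φ ^ 2 * (2 - 3 / (2 * a) * (1 - r φ)) := by
    rw [h4, Finset.mul_sum, Finset.mul_sum, Finset.mul_sum, Finset.mul_sum,
      ← Finset.sum_add_distrib, Finset.sum_div]
    refine Finset.sum_congr rfl fun φ _ => ?_
    field_simp
    ring
  -- u is 1 - E[(Y - X)² | g]/(2a). Conditioning on g instead of X loses nothing, since ψ(X) depends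
  -- only on g.
  set u : G → ℝ := fun g => 1 - (∫ h, τ.symmTrace (g * (h * α * h⁻¹)) ^ 2 ∂μ
    - 2 * (1 - a) * τ.symmTrace g ^ 2 + τ.symmTrace g ^ 2) / (2 * a) with hu_def
  -- The trivial class has multiplicity 2 and ratio 1, so its coefficient ¼·2·2 cancels the constant
  -- 1.
  have hu : ∀ g, (u g : ℂ) = ∑ φ ∈ s.erase φ₀,
      ((-(1 / 4 * (m φ * (2 - 1 / a * (1 - r φ)))) : ℝ) : ℂ) * φ.char g := fun g => by
    have h1 : (u g : ℂ)
        = 1 - ∑ φ ∈ s, ((1 / 4 * (m φ * (2 - 1 / a * (1 - r φ))) : ℝ) : ℂ) * φ.char g := by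
      simp only [hu_def]
      rw [Complex.ofReal_sub, Complex.ofReal_div, Complex.ofReal_add, Complex.ofReal_sub,
        Complex.ofReal_mul (2 * (1 - a)), hY2, hW2, Finset.mul_sum, ← Finset.sum_sub_distrib,
        ← Finset.sum_add_distrib, Finset.sum_div, Complex.ofReal_one]
      congr 1
      refine Finset.sum_congr rfl fun φ _ => ?_
      have ha' : (a : ℂ) ≠ 0 := by exact_mod_cast ha0
      simp only [hm, hr]
      push_cast
      field_simp
      ring
    rw [h1, ← Finset.add_sum_erase s _ hφ₀s, (hφ₀.char_eq_one g).1]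
    have h2 : m φ₀ = 2 := by
      simp only [hm, mult_sumConjSq_of_isTriv μ hτ hirr hnr hφ₀]
      norm_num
    have h3 : r φ₀ = 1 := by
      simp [hr, Irr.charRatio, (hφ₀.char_eq_one α).1, (hφ₀.char_eq_one α).2]
    rw [h2, h3]
    simp only [Complex.ofReal_neg, neg_mul, Finset.sum_neg_distrib]
    norm_num
  have huc : Continuous u := by
    have h1 : u = fun g => (∑ φ ∈ s.erase φ₀,
      ((-(1 / 4 * (m φ * (2 - 1 / a * (1 - r φ)))) : ℝ) : ℂ) * φ.char g).re := by
      ext g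
      rw [← hu, Complex.ofReal_re]
    rw [h1]
    exact Complex.continuous_re.comp
      (continuous_finsetSum _ fun φ _ => continuous_const.mul φ.continuous_char)
  have hu2 : ∫ g, u g ^ 2 ∂μ
      = 1 / 16 * ∑ φ ∈ s.erase φ₀, m φ ^ 2 * (2 - 1 / a * (1 - r φ)) ^ 2 := by
    simp only [sq (u _)]
    rw [Irr.integral_mul_eq_sum μ hu hu, Finset.mul_sum]
    exact Finset.sum_congr rfl fun φ _ => by ring
  set S := ∑ φ ∈ s.erase φ₀, m φ ^ 2 * (2 - 1 / a * (1 - r φ)) ^ 2 with hS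
  -- The L¹ norm is at most the L² norm. With |ψ| ≤ 2 this gives 2A = ½√S, the first term of the
  -- bound.
  have hA1 : ∫ g, |u g| ∂μ ≤ 1 / 4 * √S := by
    have h1 := sq_integral_abs_le_integral_sq (P := μ) huc
    rw [hu2] at h1
    have h2 : 1 / 4 * √S = √(1 / 16 * S) := by
      rw [Real.sqrt_mul (by norm_num), show (1 / 16 : ℝ) = (1 / 4) ^ 2 by norm_num,
        Real.sqrt_sq (by norm_num)]
    rw [h2]
    exact Real.le_sqrt_of_sq_le h1
  have hA : ∀ ψ : ℝ → ℝ, Continuous ψ → (∀ y, |ψ y| ≤ 2) →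
      |∫ p : G × G, ψ (τ.symmTrace p.1)
        * (1 - (τ.symmTrace (p.1 * (p.2 * α * p.2⁻¹)) - τ.symmTrace p.1) ^ 2 / (2 * a))
          ∂(μ.prod μ)| ≤ 2 * (1 / 4 * √S) := by
    intro ψ hψ hψ2
    rw [integral_prod _ (Continuous.integrable_of_compactSpace (by fun_prop))]
    have h1 : ∀ g, ∫ h, ψ (τ.symmTrace g)
        * (1 - (τ.symmTrace (g * (h * α * h⁻¹)) - τ.symmTrace g) ^ 2 / (2 * a)) ∂μ
        = ψ (τ.symmTrace g) * u g := fun g => by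
      have hc := hYg g
      have h2 : ∀ h, (τ.symmTrace (g * (h * α * h⁻¹)) - τ.symmTrace g) ^ 2
          = τ.symmTrace (g * (h * α * h⁻¹)) ^ 2
            - 2 * τ.symmTrace g * τ.symmTrace (g * (h * α * h⁻¹)) + τ.symmTrace g ^ 2 :=
        fun h => by ring
      simp only [h2]
      rw [integral_const_mul, integral_sub (integrable_const _)
          (Continuous.integrable_of_compactSpace (by fun_prop)), integral_div,
        integral_add (Continuous.integrable_of_compactSpace (by fun_prop)) (integrable_const _),
        integral_sub (Continuous.integrable_of_compactSpace (by fun_prop))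
          (Continuous.integrable_of_compactSpace (by fun_prop)), integral_const_mul,
        integral_symmTrace_mul_conj_apply μ hτ hirr ha]
      simp only [integral_const, probReal_univ, one_smul, hu_def]
      ring
    simp only [h1]
    have h3 : ‖∫ g, ψ (τ.symmTrace g) * u g ∂μ‖ ≤ ∫ g, 2 * |u g| ∂μ := by
      refine norm_integral_le_of_norm_le (Continuous.integrable_of_compactSpace (by fun_prop))
        (ae_of_all _ fun g => ?_)
      rw [norm_mul, Real.norm_eq_abs, Real.norm_eq_abs]
      exact mul_le_mul_of_nonneg_right (hψ2 _) (abs_nonneg _)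
    rw [integral_const_mul, Real.norm_eq_abs] at h3
    linarith
  have hmain := hpair.abs_measureReal_sub_gaussCDF_le_fourth hapos hA x
  rw [h4'] at hmain
  have hset : (μ.prod μ).real {p : G × G | τ.symmTrace p.1 ≤ x}
      = μ.real {g | τ.symmTrace g ≤ x} := by
    have h1 : {p : G × G | τ.symmTrace p.1 ≤ x} = {g | τ.symmTrace g ≤ x} ×ˢ Set.univ := by
      ext p
      simp
    rw [h1, measureReal_prod_prod, probReal_univ, mul_one]
  rw [hset] at hmain
  calc _ ≤ _ := hmain
    _ = _ := by ring

end CharacterApproximation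

end

/-! ### The theorem for compact Lie groups. -/

theorem mainTheorem2 {d : ℕ} {G : Type*} [Group G] [TopologicalSpace G] [T2Space G]
    [CompactSpace G] [ChartedSpace (EuclideanSpace ℝ (Fin d)) G] [LieGroup (𝓡 d) ∞ G]
    [MeasurableSpace G] [BorelSpace G]
    (μ : MeasureTheory.Measure G) [μ.IsHaarMeasure] [MeasureTheory.IsProbabilityMeasure μ]
    {V : Type*} [AddCommGroup V] [Module ℂ V] [FiniteDimensional ℂ V]
    [TopologicalSpace V] [IsTopologicalAddGroup V] [ContinuousSMul ℂ V] [T2Space V]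
    (τ : Representation ℂ G V) (hτ_cont : τ.IsContinuousAction) (hτ_irr : τ.IsIrreducible)
    (hτ_nonreal : ∃ g : G, (τ.character g).im ≠ 0)
    (α : G) (hα_one : α ≠ 1) (hα_conj : IsConj α α⁻¹)
    (a : ℝ) (ha : a = 1 - (τ.character α / (Module.finrank ℂ V : ℂ)).re) (ha_ne : a ≠ 0) :
    (τ.character α).im = 0 ∧
    (∀ φ : Irr G, (φ.charRatio α).im = 0) ∧
    {φ : Irr G | φ.mult τ.sumConjSq ≠ 0}.Finite ∧
    ∀ x₀ : ℝ,
      |μ.real {g : G | τ.symmTrace g ≤ x₀}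
          - 1 / √(2 * Real.pi) * ∫ x in Set.Iic x₀, Real.exp (-x ^ 2 / 2)|
        ≤ 1 / 2 * √(∑ᶠ (φ : Irr G) (_ : ¬ φ.IsTriv),
              (φ.mult τ.sumConjSq : ℝ) ^ 2
                * (2 - 1 / a * (1 - (φ.charRatio α).re)) ^ 2)
          + (1 / Real.pi * ∑ᶠ φ : Irr G,
              (φ.mult τ.sumConjSq : ℝ) ^ 2
                * (2 - 3 / (2 * a) * (1 - (φ.charRatio α).re))) ^ (1 / 4 : ℝ) := by
  classical
  have : IsTopologicalGroup G := topologicalGroup_of_lieGroup (𝓡 d) ∞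
  -- Second countability makes the product σ-algebra on G × G the Borel one, so continuous functions
  -- there are integrable.
  have : SecondCountableTopology G :=
    ChartedSpace.secondCountable_of_sigmaCompact (EuclideanSpace ℝ (Fin d)) G
  have hτ := hτ_cont.continuousCoeff
  have him := hτ.character_im_eq_zero μ hα_conj
  obtain ⟨s, hs0, hs⟩ := Irr.exists_finset_character_eq μ hτ.sumConjSq
  refine ⟨him, fun φ => φ.charRatio_im_eq_zero μ hα_conj,
    s.finite_toSet.subset fun φ hφ => by_contra fun h => hφ (hs0 φ h), fun x₀ => ?_⟩
  have ha' : τ.character α / (Module.finrank ℂ V : ℂ) = ((1 - a : ℝ) : ℂ) := by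
    refine Complex.ext ?_ ?_
    · rw [Complex.ofReal_re, ha]
      ring
    · rw [Complex.ofReal_im, Complex.div_natCast_im, him, zero_div]
  obtain ⟨φ₀, hφ₀⟩ := Irr.exists_isTriv (G := G)
  have hφ₀s : φ₀ ∈ s := by
    by_contra h
    have h1 := hs0 φ₀ h
    rw [Representation.mult_sumConjSq_of_isTriv μ hτ hτ_irr hτ_nonreal hφ₀] at h1
    exact two_ne_zero h1
  -- There is exactly one trivial class, so leaving out the trivial ones means erasing φ₀ from the
  -- finite set s.
  have hsum1 : ∑ᶠ (φ : Irr G) (_ : ¬ φ.IsTriv), (φ.mult τ.sumConjSq : ℝ) ^ 2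
        * (2 - 1 / a * (1 - (φ.charRatio α).re)) ^ 2
      = ∑ φ ∈ s.erase φ₀, (φ.mult τ.sumConjSq : ℝ) ^ 2
        * (2 - 1 / a * (1 - (φ.charRatio α).re)) ^ 2 := by
    simp only [finsum_eq_if]
    rw [finsum_eq_sum_of_support_subset (s := s.erase φ₀)]
    · refine Finset.sum_congr rfl fun φ hφ => if_pos fun h => ?_
      exact (Finset.mem_erase.1 hφ).1 (Irr.eq_of_isTriv μ h hφ₀)
    · intro φ hφ
      rw [Function.mem_support] at hφ
      rw [Finset.mem_coe, Finset.mem_erase]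
      refine ⟨fun h => hφ (if_neg (not_not.2 (h ▸ hφ₀))), by_contra fun h => hφ ?_⟩
      rw [hs0 φ h]
      simp
  have hsum2 : ∑ᶠ φ : Irr G, (φ.mult τ.sumConjSq : ℝ) ^ 2
        * (2 - 3 / (2 * a) * (1 - (φ.charRatio α).re))
      = ∑ φ ∈ s, (φ.mult τ.sumConjSq : ℝ) ^ 2
        * (2 - 3 / (2 * a) * (1 - (φ.charRatio α).re)) := by
    refine finsum_eq_sum_of_support_subset _ fun φ hφ => ?_
    rw [Function.mem_support] at hφ
    rw [Finset.mem_coe]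
    refine by_contra fun h => hφ ?_
    rw [hs0 φ h]
    simp
  rw [hsum1, hsum2]
  exact Representation.abs_measureReal_symmTrace_sub_gaussCDF_le μ hτ hτ_irr hτ_nonreal hα_conj
    ha' ha_ne hs hφ₀ hφ₀s x₀
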